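/- Let $G$ be the Heisenberg group of real matrices $\left(\begin{smallmatrix} 1 & x & y\\ 0 & 1 & z\\ 0 & 0 & 1\end{smallmatrix}\right)$, let $\Gamma\le G$ be the subgroup of those with $x,y,z\in\mathbb{Z}$, and equip $G/\Gamma$ (left cosets $g\Gamma$) with its unique $G$-invariant Borel probability measure. Let $\psi:G\to\mathbb{R}^3$ be the Mal'cev coordinate map of the basis $X_1=E_{12}$, $X_2=E_{23}$, $X_3=E_{13}$ of the Lie algebra, that is, $g=\exp(t_1X_1)\exp(t_2X_2)\exp(t_3X_3)$ if and only if $\psi(g)=(t_1,t_2,t_3)$; explicitly, \[ \psi\left(\begin{smallmatrix} 1 & x & y\\ 0 & 1 & z\\ 0 & 0 & 1\end{smallmatrix}\right)=(x,\,z,\,y-xz). \] Write $|\cdot|$ for the $\ell^\infty$-norm on $\mathbb{R}^3$. Let $d$ be the largest metric on $G$ with $d(x,y)\le|\psi(xy^{-1})|$ for all $x,y\in G$, that is, \[ d(x,y)=\inf\Big\{\sum_{i=1}^{n}\min\big(|\psi(x_{i-1}x_i^{-1})|,|\psi(x_ix_{i-1}^{-1})|\big)\;:\; n\ge 0,\ x_0,\dots,x_n\in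 G,\ x_0=x,\ x_n=y\Big\}, \] and let $d(p,q)=\inf\{d(x,y): x\Gamma=p,\ y\Gamma=q\}$ for $p,q\in G/\Gamma$. For a Lipschitz function $F:G/\Gamma\to\mathbb{C}$ put $\|F\|_{\mathrm{Lip}}=\|F\|_\infty+\sup_{p\ne q}|F(p)-F(q)|/d(p,q)$. For $\delta>0$ and an integer $N\ge1$, a sequence $(g(n)\Gamma)_{1\le n\le N}$ is called $\delta$-equidistributed if \[ \Big|\frac1N\sum_{n=1}^N F(g(n)\Gamma)-\int_{G/\Gamma}F\Big|\le\delta\|F\|_{\mathrm{Lip}} \] for every Lipschitz function $F:G/\Gamma\to\mathbb{C}$. A horizontal character is a continuous homomorphism $\eta:G\to\mathbb{R}/\mathbb{Z}$ that annihilates $\Gamma$; it has the form $\eta(g)=k\cdot\psi(g) \bmod \mathbb{Z}$ for a unique $k\in\mathbb{Z}^3$, and $|\eta|:=|k|$. For $t\in\mathbb{R}/\mathbb{Z}$ let $\|t\|_{\mathbb{R}/\mathbb{Z}}$ be the distance of $t$ to $0$. \textbf{Proposition.} There are absolute constants $C,A>0$ such that the following holds for every $a\in G$, every $\delta>0$ and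 every integer $N\ge1$: either $(a^n\Gamma)_{1\le n\le N}$ is $\delta$-equidistributed in $G/\Gamma$, or there is a horizontal character $\eta$ with \[ 0<|\eta|\le C\delta^{-A}\qquad\text{and}\qquad \|\eta(a)\|_{\mathbb{R}/\mathbb{Z}}\le\frac{C\delta^{-A}}{N}. \] (The two alternatives need not exclude each other.) -/

import Mathlib

open MeasureTheory

noncomputable section

/-- The real Heisenberg group: the element `⟨x, y, z⟩` is the unipotent matrix
`(1 x y; 0 1 z; 0 0 1)`, see `Heis.toMatrix`. -/
@[ext]
structure Heis where
  x : ℝ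
  y : ℝ
  z : ℝ

namespace Heis

/-- The matrix of an element of the Heisenberg group. -/
def toMatrix (g : Heis) : Matrix (Fin 3) (Fin 3) ℝ :=
  !![1, g.x, g.y; 0, 1, g.z; 0, 0, 1]

instance : One Heis := ⟨⟨0, 0, 0⟩⟩
instance : Mul Heis := ⟨fun g h => ⟨g.x + h.x, g.y + g.x * h.z + h.y, g.z + h.z⟩⟩
instance : Inv Heis := ⟨fun g => ⟨-g.x, g.x * g.z - g.y, -g.z⟩⟩

@[simp] theorem one_x : (1 : Heis).x = 0 := rfl
@[simp] theorem one_y : (1 : Heis).y = 0 := rfl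
@[simp] theorem one_z : (1 : Heis).z = 0 := rfl
@[simp] theorem mul_x (g h : Heis) : (g * h).x = g.x + h.x := rfl
@[simp] theorem mul_y (g h : Heis) : (g * h).y = g.y + g.x * h.z + h.y := rfl
@[simp] theorem mul_z (g h : Heis) : (g * h).z = g.z + h.z := rfl
@[simp] theorem inv_x (g : Heis) : (g⁻¹).x = -g.x := rfl
@[simp] theorem inv_y (g : Heis) : (g⁻¹).y = g.x * g.z - g.y := rfl
@[simp] theorem inv_z (g : Heis) : (g⁻¹).z = -g.z := rfl

instance : Group Heis :=
  Group.ofLeftAxioms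
    (fun a b c => by ext <;> simp <;> ring)
    (fun a => by ext <;> simp)
    (fun a => by ext <;> simp; ring)

/-- The group law is matrix multiplication. -/
theorem toMatrix_mul (g h : Heis) : (g * h).toMatrix = g.toMatrix * h.toMatrix := by
  ext i j
  fin_cases i <;> fin_cases j <;>
    simp [toMatrix, Matrix.mul_apply, Fin.sum_univ_three] <;> ring

theorem toMatrix_one : (1 : Heis).toMatrix = 1 := by
  ext i j
  fin_cases i <;> fin_cases j <;> simp [toMatrix]

theorem toMatrix_injective : Function.Injective toMatrix := by
  intro g h hgh
  have h1 := congrFun (congrFun hgh 0) 1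
  have h2 := congrFun (congrFun hgh 0) 2
  have h3 := congrFun (congrFun hgh 1) 2
  ext
  · simpa [toMatrix] using h1
  · simpa [toMatrix] using h2
  · simpa [toMatrix] using h3

/-- The matrix entries `((x, z), y)` identify the Heisenberg group with `ℝ³` as a space. -/
def entries : Heis ≃ (ℝ × ℝ) × ℝ where
  toFun g := ((g.x, g.z), g.y)
  invFun p := ⟨p.1.1, p.2, p.1.2⟩
  left_inv _ := rfl
  right_inv _ := rfl

instance : TopologicalSpace Heis := TopologicalSpace.induced entries inferInstance
instance : MeasurableSpace Heis := MeasurableSpace.comap entries inferInstance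
instance : BorelSpace Heis := ⟨by
  change MeasurableSpace.comap entries _ = _
  rw [BorelSpace.measurable_eq (α := (ℝ × ℝ) × ℝ), borel_comap]⟩

/-- `entries` as a homeomorphism. -/
def entriesHomeo : Heis ≃ₜ (ℝ × ℝ) × ℝ := entries.toHomeomorphOfIsInducing ⟨rfl⟩

theorem continuous_x : Continuous Heis.x :=
  (continuous_fst.comp continuous_fst).comp entriesHomeo.continuous
theorem continuous_y : Continuous Heis.y :=
  continuous_snd.comp entriesHomeo.continuous
theorem continuous_z : Continuous Heis.z :=
  (continuous_snd.comp continuous_fst).comp entriesHomeo.continuous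

theorem continuous_of_entries {α : Type*} [TopologicalSpace α] {f : α → Heis}
    (hx : Continuous fun a => (f a).x) (hy : Continuous fun a => (f a).y)
    (hz : Continuous fun a => (f a).z) : Continuous f :=
  continuous_induced_rng.2 ((hx.prodMk hz).prodMk hy)

instance : IsTopologicalGroup Heis where
  continuous_mul := by
    have h1 := continuous_x.comp (continuous_fst (X := Heis) (Y := Heis))
    have h2 := continuous_y.comp (continuous_fst (X := Heis) (Y := Heis))
    have h3 := continuous_z.comp (continuous_fst (X := Heis) (Y := Heis))
    have k1 := continuous_x.comp (continuous_snd (X := Heis) (Y := Heis))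
    have k2 := continuous_y.comp (continuous_snd (X := Heis) (Y := Heis))
    have k3 := continuous_z.comp (continuous_snd (X := Heis) (Y := Heis))
    exact continuous_of_entries (h1.add k1) ((h2.add (h1.mul k3)).add k2) (h3.add k3)
  continuous_inv :=
    continuous_of_entries continuous_x.neg
      ((continuous_x.mul continuous_z).sub continuous_y) continuous_z.neg

instance : PolishSpace Heis := entriesHomeo.isClosedEmbedding.polishSpace

/-- Lebesgue measure in the matrix entries, a two-sided Haar measure of the Heisenberg group. -/
instance : MeasureSpace Heis := ⟨Measure.map entriesHomeo.symm volume⟩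

theorem measurePreserving_entries : MeasurePreserving entriesHomeo.toMeasurableEquiv :=
  MeasurePreserving.symm entriesHomeo.toMeasurableEquiv.symm
    ⟨entriesHomeo.toMeasurableEquiv.symm.measurable, rfl⟩

instance : Measure.IsMulLeftInvariant (volume : Measure Heis) where
  map_mul_left_eq_self g := by
    have h : MeasurePreserving (fun p : (ℝ × ℝ) × ℝ =>
        ((g.x + p.1.1, g.z + p.1.2), g.y + g.x * p.1.2 + p.2)) := by
      have h1 : MeasurePreserving (fun p : ℝ × ℝ => (g.x + p.1, g.z + p.2)) :=
        (measurePreserving_add_left volume g.x).prod (measurePreserving_add_left volume g.z)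
      refine h1.skew_product (g := fun p y => g.y + g.x * p.2 + y) ?_ ?_
      · exact Continuous.measurable (by fun_prop)
      · exact Filter.Eventually.of_forall fun p => map_add_left_eq_self volume _
    exact ((MeasurePreserving.symm _ measurePreserving_entries).comp
      (h.comp measurePreserving_entries)).map_eq

instance : Measure.IsMulRightInvariant (volume : Measure Heis) where
  map_mul_right_eq_self g := by
    have h : MeasurePreserving (fun p : (ℝ × ℝ) × ℝ =>
        ((p.1.1 + g.x, p.1.2 + g.z), p.2 + p.1.1 * g.z + g.y)) := by
      have h1 : MeasurePreserving (fun p : ℝ × ℝ => (p.1 + g.x, p.2 + g.z)) :=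
        (measurePreserving_add_right volume g.x).prod (measurePreserving_add_right volume g.z)
      refine h1.skew_product (g := fun p y => y + p.1 * g.z + g.y) ?_ ?_
      · exact Continuous.measurable (by fun_prop)
      · refine Filter.Eventually.of_forall fun p => ?_
        simpa only [add_assoc] using map_add_right_eq_self (volume : Measure ℝ) (p.1 * g.z + g.y)
    exact ((MeasurePreserving.symm _ measurePreserving_entries).comp
      (h.comp measurePreserving_entries)).map_eq

/-- The lattice of integer matrices. -/
def Γ : Subgroup Heis where
  carrier := {g | (∃ m : ℤ, g.x = m) ∧ (∃ m : ℤ, g.y = m) ∧ ∃ m : ℤ, g.z = m}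
  one_mem' := ⟨⟨0, by simp⟩, ⟨0, by simp⟩, ⟨0, by simp⟩⟩
  mul_mem' := by
    rintro g h ⟨⟨a, ha⟩, ⟨b, hb⟩, ⟨c, hc⟩⟩ ⟨⟨a', ha'⟩, ⟨b', hb'⟩, ⟨c', hc'⟩⟩
    exact ⟨⟨a + a', by simp [ha, ha']⟩, ⟨b + a * c' + b', by simp [hb, ha, hc', hb']⟩,
      ⟨c + c', by simp [hc, hc']⟩⟩
  inv_mem' := by
    rintro g ⟨⟨a, ha⟩, ⟨b, hb⟩, ⟨c, hc⟩⟩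
    exact ⟨⟨-a, by simp [ha]⟩, ⟨a * c - b, by simp [ha, hb, hc]⟩, ⟨-c, by simp [hc]⟩⟩

/-- The Heisenberg nilmanifold `G/Γ`, the space of left cosets `gΓ`. -/
abbrev Nil : Type := Heis ⧸ Γ

/-- The unit cube, a fundamental domain for the right action of `Γ`. -/
def cube : Set Heis :=
  {g | g.x ∈ Set.Ico (0 : ℝ) 1 ∧ g.y ∈ Set.Ico (0 : ℝ) 1 ∧ g.z ∈ Set.Ico (0 : ℝ) 1}

/-- The normalised Haar measure on `G/Γ`: the image of Lebesgue measure on the unit cube.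
See `nilHaar_isProbabilityMeasure` and `nilHaar_smulInvariant`. -/
def nilHaar : Measure Nil :=
  Measure.map (QuotientGroup.mk : Heis → Nil) ((volume : Measure Heis).restrict cube)

theorem exists_unique_int_add (t : ℝ) : ∃! n : ℤ, t + n ∈ Set.Ico (0 : ℝ) 1 := by
  refine ⟨-⌊t⌋, ⟨?_, ?_⟩, ?_⟩
  · push_cast; linarith [Int.floor_le t]
  · push_cast; linarith [Int.lt_floor_add_one t]
  · rintro n ⟨h0, h1⟩
    have : ⌊t⌋ = -n := Int.floor_eq_iff.2 ⟨by push_cast; linarith, by push_cast; linarith⟩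
    omega

theorem isFundamentalDomain_cube : IsFundamentalDomain Γ.op cube (volume : Measure Heis) := by
  refine IsFundamentalDomain.mk' ?_ fun g => ?_
  · refine MeasurableSet.nullMeasurableSet ?_
    exact (continuous_x.measurable measurableSet_Ico).inter
      ((continuous_y.measurable measurableSet_Ico).inter
        (continuous_z.measurable measurableSet_Ico))
  · obtain ⟨m, hm, hm'⟩ := exists_unique_int_add g.x
    obtain ⟨n, hn, hn'⟩ := exists_unique_int_add g.z
    obtain ⟨k, hk, hk'⟩ := exists_unique_int_add (g.y + g.x * n)
    refine ⟨⟨MulOpposite.op ⟨m, k, n⟩, ⟨⟨m, rfl⟩, ⟨k, rfl⟩, ⟨n, rfl⟩⟩⟩, ⟨hm, hk, hn⟩, ?_⟩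
    rintro ⟨γ, ⟨m₁, h₁⟩, ⟨k₁, h₂⟩, ⟨n₁, h₃⟩⟩ ⟨hx, hy, hz⟩
    change (g * γ.unop).x ∈ _ at hx
    change (g * γ.unop).y ∈ _ at hy
    change (g * γ.unop).z ∈ _ at hz
    rw [mul_x, h₁] at hx
    rw [mul_z, h₃] at hz
    rw [mul_y, h₂, h₃] at hy
    obtain rfl := hm' _ hx
    obtain rfl := hn' _ hz
    obtain rfl := hk' _ hy
    apply Subtype.ext
    apply MulOpposite.unop_injective
    ext
    · exact h₁
    · exact h₂
    · exact h₃

instance : Countable Γ.op := by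
  have h : Set.Countable {g : Heis | g ∈ Γ} := by
    refine (Set.countable_range fun p : ℤ × ℤ × ℤ => (⟨p.1, p.2.1, p.2.2⟩ : Heis)).mono ?_
    rintro g ⟨⟨a, ha⟩, ⟨b, hb⟩, ⟨c, hc⟩⟩
    exact ⟨(a, b, c), Heis.ext ha.symm hb.symm hc.symm⟩
  have : Countable Γ := h.to_subtype
  exact Γ.equivOp.symm.injective.countable

theorem isClosed_Γ : IsClosed (Γ : Set Heis) := by
  have h : IsClosed (Set.range ((↑) : ℤ → ℝ)) := Int.isClosedEmbedding_coe_real.isClosed_range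
  have e : (Γ : Set Heis) = Heis.x ⁻¹' Set.range ((↑) : ℤ → ℝ) ∩
      (Heis.y ⁻¹' Set.range ((↑) : ℤ → ℝ) ∩ Heis.z ⁻¹' Set.range ((↑) : ℤ → ℝ)) := by
    ext g
    simp [Γ, eq_comm]
  rw [e]
  exact (h.preimage continuous_x).inter
    ((h.preimage continuous_y).inter (h.preimage continuous_z))

instance : T2Space Nil :=
  have : IsClosed (Γ : Set Heis) := isClosed_Γ
  inferInstance

instance nilHaar_isProbabilityMeasure : IsProbabilityMeasure nilHaar := by
  constructor
  have hm : Measurable (QuotientGroup.mk : Heis → Nil) := measurable_quotient_mk''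
  rw [nilHaar, Measure.map_apply hm MeasurableSet.univ, Set.preimage_univ,
    Measure.restrict_apply_univ]
  have e : cube = entriesHomeo.toMeasurableEquiv ⁻¹'
      ((Set.Ico (0 : ℝ) 1 ×ˢ Set.Ico (0 : ℝ) 1) ×ˢ Set.Ico (0 : ℝ) 1) := by
    ext g
    change (_ ∧ _ ∧ _) ↔ ((_ ∧ _) ∧ _)
    exact ⟨fun h => ⟨⟨h.1, h.2.2⟩, h.2.1⟩, fun h => ⟨h.1.1, h.2, h.1.2⟩⟩
  rw [e, measurePreserving_entries.measure_preimage_equiv]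
  simp [Measure.volume_eq_prod]

instance nilHaar_smulInvariant : SMulInvariantMeasure Heis Nil nilHaar := by
  have : HasFundamentalDomain Γ.op Heis (volume : Measure Heis) := ⟨⟨_, isFundamentalDomain_cube⟩⟩
  have : SMulInvariantMeasure Γ.op Heis (volume : Measure Heis) :=
    ⟨fun c s _ => measure_preimage_mul_right volume c.1.unop s⟩
  have : QuotientMeasureEqMeasurePreimage (volume : Measure Heis) nilHaar :=
    isFundamentalDomain_cube.quotientMeasureEqMeasurePreimage_quotientMeasure
  exact QuotientMeasureEqMeasurePreimage.smulInvariantMeasure_quotient (volume : Measure Heis)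

/-- The Mal'cev coordinate map of the basis `X₁ = E₁₂`, `X₂ = E₂₃`, `X₃ = E₁₃`
(see `toMatrix_eq_exp`). -/
def psi (g : Heis) : Fin 3 → ℝ := ![g.x, g.z, g.y - g.x * g.z]

theorem exp_of_sq_zero (A : Matrix (Fin 3) (Fin 3) ℝ) (h : A * A = 0) :
    NormedSpace.exp A = 1 + A := by
  rw [NormedSpace.exp_eq_tsum ℝ]
  change ∑' n : ℕ, ((n.factorial : ℝ)⁻¹) • A ^ n = 1 + A
  rw [tsum_eq_sum (s := Finset.range 2)]
  · simp [Finset.sum_range_succ]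
  · intro n hn
    have hn' : 2 ≤ n := by simpa [Nat.succ_le_iff] using hn
    obtain ⟨k, rfl⟩ := Nat.exists_eq_add_of_le hn'
    simp [pow_add, pow_two, h]

/-- `g = exp(t₁X₁) exp(t₂X₂) exp(t₃X₃)` with `(t₁, t₂, t₃) = psi g`. -/
theorem toMatrix_eq_exp (g : Heis) :
    g.toMatrix =
      NormedSpace.exp (psi g 0 • (!![0, 1, 0; 0, 0, 0; 0, 0, 0] : Matrix (Fin 3) (Fin 3) ℝ)) *
      NormedSpace.exp (psi g 1 • (!![0, 0, 0; 0, 0, 1; 0, 0, 0] : Matrix (Fin 3) (Fin 3) ℝ)) *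
      NormedSpace.exp (psi g 2 • (!![0, 0, 1; 0, 0, 0; 0, 0, 0] : Matrix (Fin 3) (Fin 3) ℝ)) := by
  rw [exp_of_sq_zero, exp_of_sq_zero, exp_of_sq_zero]
  · ext i j
    fin_cases i <;> fin_cases j <;>
      simp [toMatrix, psi, Matrix.mul_apply, Fin.sum_univ_three, Matrix.one_apply]
  all_goals
    ext i j
    fin_cases i <;> fin_cases j <;> simp [Matrix.mul_apply, Fin.sum_univ_three]

/-- The metric on `G` determined by the Mal'cev basis: the infimum, over all finite chains
`x = c 0, c 1, …, c n = y`, of `∑ min (|ψ(c i * (c (i+1))⁻¹)|, |ψ(c (i+1) * (c i)⁻¹)|)`, where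
`|·|` is the sup norm on `ℝ³`. -/
def heisDist (x y : Heis) : ℝ :=
  sInf {r : ℝ | ∃ (n : ℕ) (c : ℕ → Heis), c 0 = x ∧ c n = y ∧
    r = ∑ i ∈ Finset.range n,
      min ‖psi (c i * (c (i + 1))⁻¹)‖ ‖psi (c (i + 1) * (c i)⁻¹)‖}

/-- The induced metric on `G/Γ`. -/
def nilDist (p q : Nil) : ℝ :=
  sInf {r : ℝ | ∃ x y : Heis, (QuotientGroup.mk x : Nil) = p ∧ (QuotientGroup.mk y : Nil) = q ∧
    r = heisDist x y}

/-- Lipschitz functions on `G/Γ`. -/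
def IsLipschitz (F : Nil → ℂ) : Prop :=
  ∃ K : ℝ, ∀ p q : Nil, ‖F p - F q‖ ≤ K * nilDist p q

/-- The Lipschitz norm `‖F‖_∞ + sup_{p ≠ q} |F p - F q| / d(p, q)`. Both suprema are finite for
Lipschitz `F`, since `G/Γ` has finite diameter. -/
def lipNorm (F : Nil → ℂ) : ℝ :=
  (⨆ p : Nil, ‖F p‖) +
    ⨆ pq : {pq : Nil × Nil // pq.1 ≠ pq.2}, ‖F pq.1.1 - F pq.1.2‖ / nilDist pq.1.1 pq.1.2

/-- The finite sequence `(g(n)Γ)`, `1 ≤ n ≤ N`, is `δ`-equidistributed in `G/Γ`. -/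
def IsEquidistributed (g : ℤ → Heis) (N : ℕ) (δ : ℝ) : Prop :=
  ∀ F : Nil → ℂ, IsLipschitz F →
    ‖(∑ n ∈ Finset.Icc (1 : ℤ) N, F (QuotientGroup.mk (g n))) / (N : ℂ) - ∫ p, F p ∂nilHaar‖
      ≤ δ * lipNorm F

/-- Horizontal characters: continuous homomorphisms `G → ℝ/ℤ` that annihilate `Γ`. -/
structure HorizontalCharacter where
  toFun : Heis → UnitAddCircle
  map_mul' : ∀ g h : Heis, toFun (g * h) = toFun g + toFun h
  continuous_toFun : Continuous toFun
  annihilates : ∀ γ ∈ Γ, toFun γ = 0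

namespace HorizontalCharacter

/-- `k ∈ ℤ³` is the frequency of `η` if `η(g) = k · ψ(g) mod ℤ` for all `g`. -/
def IsFrequency (η : HorizontalCharacter) (k : Fin 3 → ℤ) : Prop :=
  ∀ g : Heis, η.toFun g = ((∑ i, (k i : ℝ) * psi g i : ℝ) : UnitAddCircle)

/-- The modulus `|η| = |k|` (sup norm) of a horizontal character with frequency `k`; the frequency
is unique, see `modulus_eq`. -/
def modulus (η : HorizontalCharacter) : ℝ :=
  sInf {r : ℝ | ∃ k : Fin 3 → ℤ, η.IsFrequency k ∧ r = ‖k‖}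

theorem IsFrequency.unique {η : HorizontalCharacter} {k l : Fin 3 → ℤ}
    (hk : η.IsFrequency k) (hl : η.IsFrequency l) : k = l := by
  have key : ∀ d : ℤ, (∀ t : ℝ, ∃ n : ℤ, (n : ℝ) = d * t) → d = 0 := by
    intro d h
    by_contra hd
    have hd' : (d : ℝ) ≠ 0 := by exact_mod_cast hd
    obtain ⟨n, hn⟩ := h (1 / (2 * d))
    have h2 : (2 * n : ℝ) = 1 := by rw [hn]; field_simp
    have h3 : 2 * n = 1 := by exact_mod_cast h2
    omega
  have main : ∀ g : Heis, ∃ n : ℤ, (n : ℝ) = ∑ i, ((k i - l i : ℤ) : ℝ) * psi g i := by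
    intro g
    have h := (hk g).symm.trans (hl g)
    rw [← sub_eq_zero, ← AddCircle.coe_sub, AddCircle.coe_eq_zero_iff] at h
    obtain ⟨n, hn⟩ := h
    refine ⟨n, ?_⟩
    simp only [zsmul_eq_mul, mul_one] at hn
    rw [hn, ← Finset.sum_sub_distrib]
    exact Finset.sum_congr rfl fun i _ => by push_cast; ring
  funext i
  rw [← sub_eq_zero]
  apply key
  intro t
  fin_cases i
  · simpa [psi, Fin.sum_univ_three] using main ⟨t, 0, 0⟩
  · simpa [psi, Fin.sum_univ_three] using main ⟨0, 0, t⟩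
  · simpa [psi, Fin.sum_univ_three] using main ⟨0, t, 0⟩

theorem modulus_eq {η : HorizontalCharacter} {k : Fin 3 → ℤ} (hk : η.IsFrequency k) :
    η.modulus = ‖k‖ := by
  have : {r : ℝ | ∃ l : Fin 3 → ℤ, η.IsFrequency l ∧ r = ‖l‖} = {‖k‖} := by
    ext r
    constructor
    · rintro ⟨l, hl, rfl⟩
      rw [hk.unique hl]; rfl
    · rintro rfl
      exact ⟨k, hk, rfl⟩
  rw [modulus, this, csInf_singleton]

end HorizontalCharacter

end Heis

end

noncomputable section

/-! Suppose no nontrivial integer combination of `a.x` and `a.z` with coefficients at most Q lies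
within Q/N of an integer, where Q is a power of 1/δ (`NonRat`). If this fails, the offending
relation is itself the required horizontal character. If it holds, averages of a normalised
Lipschitz function F along the orbit must be within δ of its integral.

The centre acts on G/Γ through a circle, so Fejér summation along it writes F, up to a small uniform
error, as a combination of functions on which the centre acts by a character of frequency ξ
(`norm_sub_sum_vert_le`). For ξ = 0 the function lives on the torus with coordinates (x, z); it is
approximated by a trigonometric polynomial, and the averages are geometric sums
(`norm_avg_sub_integral_le_of_cen_invariant`).

For ξ ≠ 0 the integral vanishes, and the squared orbit sum is a sum of autocorrelations at shifts h
(van der Corput). Replace a^h by an element b of the same coset with x, z in [0, 1). Moving a^n past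
b costs a central factor linear in n, so the correlation is e(nθ(h)) times a torus function whose
Lipschitz constant does not depend on h, where θ(h) = ξ(x{hz} − z{hx}). It sums to little unless
θ(h) + kx + lz is close to an integer for some small k, l (`norm_autocorrelation_le`).

The heart is that such h are rare (`card_bracket_le`). Either {hx} is nearly constant on the bad h
of each short block, which is rare by a second moment bound (`card_le_of_fract_close`), or, if the
bad h were many, pigeonhole would give bad integers with h − h' = t(h₁ − h₂) whose fractional parts
cannot obey the same relation. The discrepancies are integer carries, and the corresponding
combination of values of θ is a forbidden integer relation between x and z (`not_nonRat_of_carry`).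
-/

namespace Heis

/-! ### Exponential sums and the Fejér kernel. -/

/-- The standard character `t ↦ e^{2πit}` of `ℝ/ℤ`. -/
def ee (t : ℝ) : ℂ := Complex.exp ((2 * Real.pi * t : ℝ) * Complex.I)

theorem ee_add (s t : ℝ) : ee (s + t) = ee s * ee t := by
  rw [ee, ee, ee, ← Complex.exp_add]; congr 1; push_cast; ring

@[simp] theorem ee_zero : ee 0 = 1 := by simp [ee]

@[simp] theorem norm_ee (t : ℝ) : ‖ee t‖ = 1 := Complex.norm_exp_ofReal_mul_I _

theorem star_ee (t : ℝ) : star (ee t) = ee (-t) := by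
  rw [ee, ee, Complex.star_def, ← Complex.exp_conj]; congr 1
  simp only [map_mul, Complex.conj_ofReal, Complex.conj_I]; push_cast; ring

@[simp] theorem ee_int (n : ℤ) : ee n = 1 := by
  rw [ee, Complex.exp_eq_one_iff]; exact ⟨n, by push_cast; ring⟩

theorem ee_add_int (t : ℝ) (n : ℤ) : ee (t + n) = ee t := by rw [ee_add, ee_int, mul_one]

theorem ee_half : ee (1 / 2) = -1 := by
  rw [ee, ← Complex.exp_pi_mul_I]; congr 1; push_cast; ring

theorem continuous_ee : Continuous ee := by unfold ee; fun_prop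

theorem ee_nat_mul (n : ℕ) (t : ℝ) : ee (n * t) = ee t ^ n := by
  rw [ee, ee, ← Complex.exp_nat_mul]; congr 1; push_cast; ring

theorem norm_coe_le_abs (t : ℝ) : ‖(t : UnitAddCircle)‖ ≤ |t| := by
  rw [UnitAddCircle.norm_eq]
  simpa using round_le t 0

theorem coe_add_int (t : ℝ) (n : ℤ) : ((t + n : ℝ) : UnitAddCircle) = t := by
  rw [← sub_eq_zero, ← AddCircle.coe_sub, AddCircle.coe_eq_zero_iff]
  exact ⟨n, by simp⟩

theorem norm_coe_le_half (t : ℝ) : ‖(t : UnitAddCircle)‖ ≤ 1 / 2 := by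
  rw [UnitAddCircle.norm_eq]; exact abs_sub_round t

/-- The chord is at least `4 / (2π)` times the arc. -/
theorem four_mul_norm_le (t : ℝ) : 4 * ‖(t : UnitAddCircle)‖ ≤ ‖ee t - 1‖ := by
  have h1 : ee t = ee (t - round t) := by
    conv_lhs => rw [← sub_add_cancel t (round t : ℝ)]
    rw [ee_add_int]
  rw [UnitAddCircle.norm_eq, h1]
  have h2 := abs_sub_round t
  set s := t - round t
  have hpi := Real.pi_pos
  rw [ee, mul_comm _ Complex.I, Complex.norm_exp_I_mul_ofReal_sub_one, norm_mul, Real.norm_eq_abs,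
    Real.norm_eq_abs, abs_two]
  have h3 : 2 * Real.pi * s / 2 = Real.pi * s := by ring
  have h4 : |Real.pi * s| ≤ Real.pi / 2 := by
    rw [abs_mul, abs_of_pos hpi]; nlinarith
  have h5 := Real.mul_abs_le_abs_sin h4
  rw [abs_mul, abs_of_pos hpi] at h5
  have h6 : 2 / Real.pi * (Real.pi * |s|) = 2 * |s| := by field_simp
  rw [h3]; linarith

/-- Multiply the geometric sum by e(t) − 1: the result has modulus at most 2, while the factor has
modulus at least 4‖t‖. The product form needs no assumption that t is not an integer. -/
theorem norm_range_sum_ee_mul_le (n : ℕ) (t : ℝ) :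
    ‖∑ j ∈ Finset.range n, ee (j * t)‖ * ‖(t : UnitAddCircle)‖ ≤ 1 / 2 := by
  have h := geom_sum_mul (ee t) n
  simp_rw [← ee_nat_mul] at h
  have h1 := congrArg norm h
  rw [norm_mul] at h1
  have h2 : ‖ee (n * t) - 1‖ ≤ 2 := (norm_sub_le _ _).trans (by simp; norm_num)
  have h3 := mul_le_mul_of_nonneg_left (four_mul_norm_le t)
    (norm_nonneg (∑ j ∈ Finset.range n, ee (j * t)))
  linarith

/-- The geometric sum bound for exponential sums over intervals of integers. -/
theorem norm_Icc_sum_ee_mul_le (u v : ℤ) (t : ℝ) :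
    ‖∑ n ∈ Finset.Icc u v, ee (n * t)‖ * ‖(t : UnitAddCircle)‖ ≤ 1 / 2 := by
  have h : ∑ n ∈ Finset.Icc u v, ee (n * t) =
      ee (u * t) * ∑ j ∈ Finset.range (v + 1 - u).toNat, ee (j * t) := by
    rw [Finset.mul_sum, Int.Icc_eq_finset_map, Finset.sum_map]
    refine Finset.sum_congr rfl fun j _ => ?_
    rw [← ee_add]; congr 1; simp; ring
  rw [h, norm_mul, norm_ee, one_mul]
  exact norm_range_sum_ee_mul_le _ _

/-- The Fejér kernel. -/
def fejer (M : ℕ) (t : ℝ) : ℝ := ‖∑ j ∈ Finset.range M, ee (j * t)‖ ^ 2 / M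

theorem fejer_nonneg (M : ℕ) (t : ℝ) : 0 ≤ fejer M t := by unfold fejer; positivity

theorem norm_sq_range_sum_ee (M : ℕ) (t : ℝ) :
    ((‖∑ j ∈ Finset.range M, ee (j * t)‖ ^ 2 : ℝ) : ℂ) =
      ∑ i ∈ Finset.range M, ∑ j ∈ Finset.range M, ee (((i : ℤ) - (j : ℤ) : ℤ) * t) := by
  rw [Complex.ofReal_pow, ← Complex.mul_conj', map_sum, Finset.sum_mul_sum]
  refine Finset.sum_congr rfl fun i _ => Finset.sum_congr rfl fun j _ => ?_
  have := star_ee (j * t)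
  rw [Complex.star_def] at this
  rw [this, ← ee_add]; congr 1; push_cast; ring

theorem fejer_eq (M : ℕ) (t : ℝ) : (fejer M t : ℂ) =
    (∑ i ∈ Finset.range M, ∑ j ∈ Finset.range M, ee (((i : ℤ) - (j : ℤ) : ℤ) * t)) / M := by
  rw [fejer, ← norm_sq_range_sum_ee, Complex.ofReal_div, Complex.ofReal_natCast]

theorem continuous_fejer (M : ℕ) : Continuous (fejer M) := by
  have := continuous_ee
  unfold fejer; fun_prop

/-- The geometric sum bound gives f·(√M s)² ≤ 1/4 for the kernel value f and the distance s to the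
integers; expanding f(2√M s − 1)² ≥ 0 turns this into a bound linear in s. Averaged against total
mass one, it makes Fejér means of a Lipschitz function accurate to O(1/√M) without splitting the
range. -/
theorem fejer_mul_norm_le {M : ℕ} (hM : 0 < M) (t : ℝ) :
    fejer M t * ‖(t : UnitAddCircle)‖ ≤ (fejer M t + 1) / (2 * √M) := by
  have hM' : (0 : ℝ) < √M := Real.sqrt_pos.2 (by exact_mod_cast hM)
  have hs : √(M : ℝ) ^ 2 = M := Real.sq_sqrt (by positivity)
  have h := norm_range_sum_ee_mul_le M t
  have hf : fejer M t * √M ^ 2 = ‖∑ j ∈ Finset.range M, ee (j * t)‖ ^ 2 := by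
    rw [hs, fejer, div_mul_cancel₀ _ (by positivity)]
  set f := fejer M t
  set s := ‖(t : UnitAddCircle)‖
  set D := ‖∑ j ∈ Finset.range M, ee (j * t)‖
  set r := √(M : ℝ)
  have hs0 : 0 ≤ s := norm_nonneg _
  have hD0 : 0 ≤ D := norm_nonneg _
  have hf0 : 0 ≤ f := fejer_nonneg _ _
  have h1 : (D * s) ^ 2 ≤ (1 / 2) ^ 2 := pow_le_pow_left₀ (by positivity) h 2
  have h2 : f * (r * s) ^ 2 ≤ 1 / 4 := by
    calc f * (r * s) ^ 2 = (D * s) ^ 2 := by rw [mul_pow, mul_pow, ← hf]; ring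
      _ ≤ _ := by linarith
  rw [le_div_iff₀ (by positivity)]
  nlinarith [mul_nonneg hf0 (sq_nonneg (2 * (r * s) - 1))]

theorem sum_ee_div_eq_zero {M : ℕ} {k : ℤ} (hk : k ≠ 0) (hkM : |k| < M) :
    ∑ a ∈ Finset.range M, ee (a * (k / M : ℝ)) = 0 := by
  have hM : 0 < M := by have := abs_nonneg k; omega
  have hM' : (M : ℝ) ≠ 0 := by positivity
  simp_rw [ee_nat_mul]
  have h1 : ee (k / M) ≠ 1 := by
    intro h
    have h4 := four_mul_norm_le (k / M : ℝ)
    rw [h, sub_self, norm_zero] at h4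
    have h5 : ((k / M : ℝ) : UnitAddCircle) = 0 := by
      rw [← norm_eq_zero]; linarith [norm_nonneg ((k / M : ℝ) : UnitAddCircle)]
    rw [AddCircle.coe_eq_zero_iff] at h5
    obtain ⟨n, hn⟩ := h5
    have h6 : (k : ℝ) = n * M := by
      simp at hn; field_simp at hn; linarith
    have h7 : k = n * M := by exact_mod_cast h6
    have h8 := Int.eq_zero_of_abs_lt_dvd (m := M) (x := k) ⟨n, by rw [h7]; ring⟩ hkM
    exact hk h8
  rw [geom_sum_eq h1, ← ee_nat_mul]
  have : (M : ℝ) * (k / M) = (k : ℤ) := by field_simp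
  rw [this, ee_int, sub_self, zero_div]

theorem abs_sub_lt_of_mem_range {M i j : ℕ} (hi : i ∈ Finset.range M) (hj : j ∈ Finset.range M) :
    |(i : ℤ) - (j : ℤ)| < M := by
  rw [Finset.mem_range] at hi hj
  rw [abs_lt]; omega

/-- Translates of the Fejér kernel by `M`-th fractions form a partition of unity. -/
theorem sum_fejer (M : ℕ) (hM : 0 < M) (t : ℝ) :
    ∑ a ∈ Finset.range M, fejer M (t - a / M) = M := by
  have hM' : (M : ℂ) ≠ 0 := by exact_mod_cast hM.ne'
  rw [← Complex.ofReal_inj, Complex.ofReal_sum]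
  simp_rw [fejer_eq]
  rw [← Finset.sum_div, Finset.sum_comm]
  have : ∀ i ∈ Finset.range M, ∑ a ∈ Finset.range M, ∑ j ∈ Finset.range M,
      ee (((i : ℤ) - (j : ℤ) : ℤ) * (t - a / M)) = M := by
    intro i hi
    rw [Finset.sum_comm, Finset.sum_eq_single i]
    · simp
    · intro j hj hji
      have h1 : ∀ a ∈ Finset.range M, ee (((i : ℤ) - (j : ℤ) : ℤ) * (t - a / M)) =
          ee (((i : ℤ) - (j : ℤ) : ℤ) * t) * ee (a * (((j : ℤ) - (i : ℤ) : ℤ) / M : ℝ)) := by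
        intro a _
        rw [← ee_add]; congr 1; push_cast; ring
      rw [Finset.sum_congr rfl h1, ← Finset.mul_sum,
        sum_ee_div_eq_zero (by omega) (abs_sub_lt_of_mem_range hj hi), mul_zero]
    · intro h; exact absurd hi h
  rw [Finset.sum_congr rfl this]
  simp

theorem integral_ee_int_mul {k : ℤ} (hk : k ≠ 0) : ∫ c in (0 : ℝ)..1, ee (k * c) = 0 := by
  have hpi := Real.pi_ne_zero
  have hk' : (2 * Real.pi * k * Complex.I : ℂ) ≠ 0 := by
    simp [hpi, hk]
  have h := integral_exp_mul_complex (a := 0) (b := 1) hk'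
  have h1 : ∀ c : ℝ, ee (k * c) = Complex.exp (2 * Real.pi * k * Complex.I * c) := by
    intro c; rw [ee]; congr 1; push_cast; ring
  simp_rw [h1]
  rw [h, ← h1, ← h1]; simp

theorem integral_fejer (M : ℕ) (hM : 0 < M) : ∫ c in (0 : ℝ)..1, fejer M c = 1 := by
  have hM' : (M : ℂ) ≠ 0 := by exact_mod_cast hM.ne'
  have hc : ∀ k : ℤ, Continuous fun c : ℝ => ee (k * c) := fun k =>
    continuous_ee.comp (by fun_prop)
  rw [← Complex.ofReal_inj, ← intervalIntegral.integral_ofReal]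
  simp_rw [fejer_eq]
  rw [intervalIntegral.integral_div, intervalIntegral.integral_finsetSum]
  · have : ∀ i ∈ Finset.range M, ∫ c in (0 : ℝ)..1, ∑ j ∈ Finset.range M,
        ee (((i : ℤ) - (j : ℤ) : ℤ) * c) = 1 := by
      intro i hi
      rw [intervalIntegral.integral_finsetSum fun j _ => (hc _).intervalIntegrable _ _,
        Finset.sum_eq_single i]
      · simp
      · intro j _ hji
        exact integral_ee_int_mul (by omega)
      · intro h; exact absurd hi h
    rw [Finset.sum_congr rfl this]
    simp [hM']
  · intro i _
    exact (continuous_finsetSum _ fun j _ => hc _).intervalIntegrable _ _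

/-- The Fourier coefficients of the Fejér kernel. -/
def fejerCoeff (M : ℕ) (k : ℤ) : ℝ :=
  (({p ∈ Finset.range M ×ˢ Finset.range M | (p.1 : ℤ) - (p.2 : ℤ) = k} :
    Finset (ℕ × ℕ)).card : ℝ) / M

theorem fejerCoeff_nonneg (M : ℕ) (k : ℤ) : 0 ≤ fejerCoeff M k := by
  unfold fejerCoeff; positivity

theorem fejerCoeff_le_one (M : ℕ) (k : ℤ) : fejerCoeff M k ≤ 1 := by
  refine div_le_one_of_le₀ ?_ (Nat.cast_nonneg _)
  have h : ({p ∈ Finset.range M ×ˢ Finset.range M | (p.1 : ℤ) - (p.2 : ℤ) = k} :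
      Finset (ℕ × ℕ)).card ≤ (Finset.range M).card := by
    refine Finset.card_le_card_of_injOn Prod.fst ?_ ?_
    · intro p hp
      simp only [Finset.coe_filter, Set.mem_ofPred_eq, Finset.mem_product] at hp
      exact hp.1.1
    · rintro ⟨i, j⟩ hp ⟨i', j'⟩ hp' h
      simp only [Finset.coe_filter, Set.mem_ofPred_eq] at hp hp' h
      ext
      · exact h
      · simp only; omega
  rw [Finset.card_range] at h
  exact_mod_cast h

theorem fejer_eq_sum_fejerCoeff (M : ℕ) (t : ℝ) : (fejer M t : ℂ) =
    ∑ k ∈ Finset.Ioo (-(M : ℤ)) M, (fejerCoeff M k : ℂ) * ee (k * t) := by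
  rw [fejer_eq, ← Finset.sum_product', ← Finset.sum_fiberwise_of_maps_to
    (t := Finset.Ioo (-(M : ℤ)) M) (g := fun p : ℕ × ℕ => (p.1 : ℤ) - (p.2 : ℤ)), Finset.sum_div]
  · refine Finset.sum_congr rfl fun k _ => ?_
    rw [Finset.sum_congr rfl (g := fun _ => ee (k * t))
      fun p hp => by rw [(Finset.mem_filter.1 hp).2]]
    rw [Finset.sum_const, nsmul_eq_mul, fejerCoeff]
    push_cast; ring
  · intro p hp
    rw [Finset.mem_product] at hp
    have := abs_lt.1 (abs_sub_lt_of_mem_range hp.1 hp.2)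
    exact Finset.mem_Ioo.2 this

/-! ### Horizontal irrationality and bracket-linear forms. -/

/-- No nonzero integer combination of `x` and `z` with coefficients at most `Q` is within `Q / N`
of an integer. -/
def NonRat (x z : ℝ) (N : ℕ) (Q : ℝ) : Prop :=
  ∀ k l : ℤ, k ≠ 0 ∨ l ≠ 0 → |(k : ℝ)| ≤ Q → |(l : ℝ)| ≤ Q →
    Q / N < ‖((k * x + l * z : ℝ) : UnitAddCircle)‖

theorem half_le_re_ee {t : ℝ} (ht : |t| ≤ 1 / 8) : 1 / 2 ≤ (ee t).re := by
  rw [ee, Complex.exp_ofReal_mul_I_re]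
  have h := Real.one_sub_sq_div_two_le_cos (x := 2 * Real.pi * t)
  have h1 : (2 * Real.pi * t) ^ 2 ≤ 1 := by
    rw [sq_le_one_iff_abs_le_one, abs_mul, abs_of_pos (by positivity)]
    nlinarith [Real.pi_lt_d2, Real.pi_pos]
  linarith

theorem half_le_norm_range_sum_ee {K : ℕ} (hK : 0 < K) {t : ℝ}
    (ht : ‖(t : UnitAddCircle)‖ ≤ 1 / (8 * K)) :
    (K : ℝ) / 2 ≤ ‖∑ j ∈ Finset.range K, ee (j * t)‖ := by
  have hK' : (0 : ℝ) < K := by exact_mod_cast hK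
  refine le_trans ?_ (Complex.re_le_norm _)
  rw [Complex.re_sum]
  have : ∀ j ∈ Finset.range K, (1 / 2 : ℝ) ≤ (ee (j * t)).re := by
    intro j hj
    have hj' : (j : ℝ) ≤ K := by exact_mod_cast (Finset.mem_range.1 hj).le
    have h1 : ee (j * t) = ee (j * (t - round t)) := by
      have : (j : ℝ) * t = j * (t - round t) + ((j * round t : ℤ) : ℝ) := by push_cast; ring
      rw [this, ee_add_int]
    rw [h1]
    apply half_le_re_ee
    rw [UnitAddCircle.norm_eq] at ht
    rw [abs_mul, Nat.abs_cast]
    calc (j : ℝ) * |t - round t| ≤ K * (1 / (8 * K)) := by gcongr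
      _ = 1 / 8 := by field_simp
  calc (K : ℝ) / 2 = ∑ j ∈ Finset.range K, (1 / 2 : ℝ) := by simp; ring
    _ ≤ _ := Finset.sum_le_sum this

/-- Few integers in an interval have all their multiples of `x` in a short arc. -/
theorem card_le_of_fract_close {K N : ℕ} (hK : 0 < K) (hN : 0 < N) {Q x : ℝ} (hQ : 0 < Q)
    (hx : ∀ k : ℤ, k ≠ 0 → |(k : ℝ)| ≤ K → Q / N < ‖((k * x : ℝ) : UnitAddCircle)‖)
    {u v : ℤ} {S : Finset ℤ} (hSI : S ⊆ Finset.Icc u v)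
    (hS : ∀ h ∈ S, ∀ h' ∈ S, |Int.fract (h * x) - Int.fract (h' * x)| ≤ 1 / (8 * K)) :
    (S.card : ℝ) ≤ 4 * (Finset.Icc u v).card / K + 2 * N / Q := by
  have hK' : (0 : ℝ) < K := by exact_mod_cast hK
  have hN' : (0 : ℝ) < N := by exact_mod_cast hN
  obtain rfl | ⟨h₀, hh₀⟩ := S.eq_empty_or_nonempty
  · simp; positivity
  -- Each difference h − h₀ puts (h − h₀)x within 1/(8K) of an integer, so the K phases are all
  -- within 1/8 of a full turn from 1 and do not cancel.
  have lower : ∀ h ∈ S, (K : ℝ) ^ 2 / 4 ≤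
      ‖∑ j ∈ Finset.range K, ee (j * ((h - h₀) * x))‖ ^ 2 := by
    intro h hh
    have h1 : ‖(((h - h₀) * x : ℝ) : UnitAddCircle)‖ ≤ 1 / (8 * K) := by
      have h2 : ((h - h₀) * x : ℝ) = (Int.fract (h * x) - Int.fract (h₀ * x)) +
          ((⌊h * x⌋ - ⌊h₀ * x⌋ : ℤ) : ℝ) := by
        push_cast
        linarith [Int.floor_add_fract (h * x), Int.floor_add_fract (h₀ * x)]
      rw [h2, coe_add_int]
      exact (norm_coe_le_abs _).trans (hS h hh h₀ hh₀)
    have h3 := half_le_norm_range_sum_ee hK h1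
    calc (K : ℝ) ^ 2 / 4 = (K / 2) ^ 2 := by ring
      _ ≤ _ := pow_le_pow_left₀ (by positivity) h3 2
  -- Second moment over the whole interval: the diagonal gives K times its length, and each
  -- off-diagonal pair gives a geometric sum of frequency (i − j)x, at most N/(2Q) by hypothesis.
  have upper : ∑ h ∈ Finset.Icc u v, ‖∑ j ∈ Finset.range K, ee (j * ((h - h₀) * x))‖ ^ 2 ≤
      K * (Finset.Icc u v).card + K ^ 2 * (N / (2 * Q)) := by
    set c := (Finset.Icc u v).card
    have h1 : ((∑ h ∈ Finset.Icc u v, ‖∑ j ∈ Finset.range K, ee (j * ((h - h₀) * x))‖ ^ 2 : ℝ) : ℂ)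
        = ∑ i ∈ Finset.range K, ∑ j ∈ Finset.range K, ∑ h ∈ Finset.Icc u v,
          ee (((i : ℤ) - (j : ℤ) : ℤ) * ((h - h₀) * x)) := by
      rw [Complex.ofReal_sum]
      simp_rw [norm_sq_range_sum_ee]
      rw [Finset.sum_comm]
      refine Finset.sum_congr rfl fun i _ => Finset.sum_comm
    have h2 : ∀ i ∈ Finset.range K, ∀ j ∈ Finset.range K, ‖∑ h ∈ Finset.Icc u v,
          ee (((i : ℤ) - (j : ℤ) : ℤ) * ((h - h₀) * x))‖ ≤
          (if i = j then (c : ℝ) else 0) + N / (2 * Q) := by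
      intro i hi j hj
      by_cases hij : i = j
      · subst hij
        simp only [sub_self, Int.cast_zero, zero_mul, ee_zero, if_true]
        simp only [Finset.sum_const, nsmul_eq_mul, mul_one, Complex.norm_natCast]
        have : 0 ≤ (N : ℝ) / (2 * Q) := by positivity
        linarith
      · set k : ℤ := (i : ℤ) - (j : ℤ) with hk
        have hk0 : k ≠ 0 := by omega
        have hkK : |(k : ℝ)| ≤ K := by
          have := abs_sub_lt_of_mem_range hi hj
          rw [← hk] at this
          exact_mod_cast this.le
        have h3 := hx k hk0 hkK
        have h4 := norm_Icc_sum_ee_mul_le u v (k * x)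
        have h5 : ∑ h ∈ Finset.Icc u v, ee (k * ((h - h₀) * x)) =
            ee (-(k * h₀ * x)) * ∑ h ∈ Finset.Icc u v, ee (h * (k * x)) := by
          rw [Finset.mul_sum]
          refine Finset.sum_congr rfl fun h _ => ?_
          rw [← ee_add]; congr 1; ring
        rw [h5, norm_mul, norm_ee, one_mul, if_neg hij, zero_add]
        rw [le_div_iff₀ (by positivity)]
        rw [div_lt_iff₀ hN'] at h3
        set D := ‖∑ h ∈ Finset.Icc u v, ee (h * (k * x))‖
        have hD : 0 ≤ D := norm_nonneg _
        nlinarith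
    have h3 : ∑ h ∈ Finset.Icc u v, ‖∑ j ∈ Finset.range K, ee (j * ((h - h₀) * x))‖ ^ 2 =
        ‖((∑ h ∈ Finset.Icc u v, ‖∑ j ∈ Finset.range K, ee (j * ((h - h₀) * x))‖ ^ 2 : ℝ) : ℂ)‖ := by
      rw [Complex.norm_real, Real.norm_of_nonneg]
      exact Finset.sum_nonneg fun _ _ => by positivity
    rw [h3, h1]
    calc _ ≤ ∑ i ∈ Finset.range K, ∑ j ∈ Finset.range K,
          ((if i = j then (c : ℝ) else 0) + N / (2 * Q)) := by
          refine (norm_sum_le _ _).trans (Finset.sum_le_sum fun i hi => ?_)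
          exact (norm_sum_le _ _).trans (Finset.sum_le_sum fun j hj => h2 i hi j hj)
      _ = _ := by
          simp_rw [Finset.sum_add_distrib, Finset.sum_ite_eq]
          rw [Finset.sum_congr rfl fun i hi => if_pos hi]
          simp; ring
  have total : (S.card : ℝ) * (K ^ 2 / 4) ≤
      K * (Finset.Icc u v).card + K ^ 2 * (N / (2 * Q)) := by
    refine le_trans ?_ upper
    rw [← nsmul_eq_mul]
    refine (Finset.card_nsmul_le_sum _ _ _ lower).trans ?_
    exact Finset.sum_le_sum_of_subset_of_nonneg hSI fun _ _ _ => by positivity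
  have : 4 * ((Finset.Icc u v).card : ℝ) / K + 2 * N / Q =
      (K * (Finset.Icc u v).card + K ^ 2 * (N / (2 * Q))) / (K ^ 2 / 4) := by
    field_simp; ring
  rw [this, le_div_iff₀ (by positivity)]
  exact total

/-- Four integers at which a bracket-linear form nearly vanishes, closing up to an integer
relation with a nontrivial carry, produce a nontrivial integer relation between `x` and `z`. -/
theorem not_nonRat_of_carry {x z β R Q : ℝ} {N : ℕ} {ξ : ℤ} (hξ : ξ ≠ 0) {T : ℝ}
    (hR : 0 ≤ R) (hQ₁ : |(ξ : ℝ)| * (1 + T) ≤ Q) (hQ₂ : (2 + 2 * T) * R ≤ Q)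
    {h h' h₁ h₂ t : ℤ} (ht : h - h' = t * (h₁ - h₂)) (htT : |(t : ℝ)| ≤ T)
    (hcarry : 1 ≤ |(t : ℝ)| * |Int.fract (h₁ * x) - Int.fract (h₂ * x)|)
    (hh : ∀ k ∈ ({h, h', h₁, h₂} : Finset ℤ), ‖((ξ * (x * Int.fract (k * z) -
      z * Int.fract (k * x)) + β : ℝ) : UnitAddCircle)‖ ≤ R / N) :
    ¬ NonRat x z N Q := by
  intro hnr
  have ht' : ((h : ℝ) - h') = t * (h₁ - h₂) := by exact_mod_cast ht
  -- The integer relation among h, h', h₁, h₂ cancels the main terms, so the defect in the relation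
  -- between fractional parts is an integer, the carry.
  have hv : ∀ w : ℝ, ((⌊h * w⌋ - ⌊h' * w⌋ - t * (⌊h₁ * w⌋ - ⌊h₂ * w⌋) : ℤ) : ℝ) =
      -(Int.fract (h * w) - Int.fract (h' * w) -
        t * (Int.fract (h₁ * w) - Int.fract (h₂ * w))) := by
    intro w
    push_cast
    simp only [Int.fract]
    linear_combination w * ht'
  have hf : ∀ s r : ℝ, |Int.fract s - Int.fract r| < 1 := by
    intro s r
    rw [abs_lt]
    constructor <;> linarith [Int.fract_nonneg s, Int.fract_nonneg r, Int.fract_lt_one s,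
      Int.fract_lt_one r]
  have hvT : ∀ w : ℝ, |((⌊h * w⌋ - ⌊h' * w⌋ - t * (⌊h₁ * w⌋ - ⌊h₂ * w⌋) : ℤ) : ℝ)| ≤ 1 + T := by
    intro w
    rw [hv, abs_neg]
    refine (abs_sub _ _).trans ?_
    rw [abs_mul]
    have h1 := hf (h * w) (h' * w)
    have h2 := hf (h₁ * w) (h₂ * w)
    have h3 := mul_le_mul htT h2.le (abs_nonneg _) ((abs_nonneg _).trans htT)
    linarith
  -- Without a carry, a difference of two fractional parts, which is less than 1, would equal t
  -- times another, which is at least 1 by hypothesis.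
  have hv0 : ⌊h * x⌋ - ⌊h' * x⌋ - t * (⌊h₁ * x⌋ - ⌊h₂ * x⌋) ≠ 0 := by
    intro h0
    have h1 := hv x
    rw [h0, Int.cast_zero] at h1
    have h2 : Int.fract (h * x) - Int.fract (h' * x) =
      t * (Int.fract (h₁ * x) - Int.fract (h₂ * x)) := by linarith
    have h3 := hf (h * x) (h' * x)
    rw [h2, abs_mul] at h3
    linarith
  have hvx := hv x
  have hvz := hv z
  have hTx := hvT x
  have hTz := hvT z
  set v₁ := ⌊h * x⌋ - ⌊h' * x⌋ - t * (⌊h₁ * x⌋ - ⌊h₂ * x⌋)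
  set v₂ := ⌊h * z⌋ - ⌊h' * z⌋ - t * (⌊h₁ * z⌋ - ⌊h₂ * z⌋)
  have key := hnr (-(ξ * v₂)) (ξ * v₁) (Or.inr (mul_ne_zero hξ hv0))
    (by push_cast; rw [abs_neg, abs_mul]
        exact (mul_le_mul_of_nonneg_left hTz (abs_nonneg _)).trans hQ₁)
    (by push_cast; rw [abs_mul]
        exact (mul_le_mul_of_nonneg_left hTx (abs_nonneg _)).trans hQ₁)
  set θ : ℤ → ℝ := fun k => ξ * (x * Int.fract (k * z) - z * Int.fract (k * x)) + β with hθ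
  -- In this combination β cancels, and the fractional parts enter only through the integer carries;
  -- the bracket form has become linear in x and z.
  have hsum : (((-(ξ * v₂) : ℤ) : ℝ) * x + ((ξ * v₁ : ℤ) : ℝ) * z : ℝ) =
      θ h - θ h' - t * (θ h₁ - θ h₂) := by
    push_cast
    rw [hvx, hvz]
    simp only [hθ]
    ring
  rw [hsum] at key
  have hb : ‖((θ h - θ h' - t * (θ h₁ - θ h₂) : ℝ) : UnitAddCircle)‖ ≤
      R / N + R / N + |(t : ℝ)| * (R / N + R / N) := by
    have e : ((θ h - θ h' - t * (θ h₁ - θ h₂) : ℝ) : UnitAddCircle) =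
        (θ h : UnitAddCircle) - θ h' - t • ((θ h₁ : UnitAddCircle) - θ h₂) := by
      rw [← zsmul_eq_mul]
      rfl
    rw [e]
    refine (norm_sub_le _ _).trans (add_le_add ?_ ?_)
    · exact (norm_sub_le _ _).trans (add_le_add (hh h (by simp)) (hh h' (by simp)))
    · refine (norm_zsmul_le _ _).trans ?_
      rw [Int.norm_eq_abs]
      refine mul_le_mul_of_nonneg_left ?_ (abs_nonneg _)
      exact (norm_sub_le _ _).trans (add_le_add (hh h₁ (by simp)) (hh h₂ (by simp)))
  have hRN : 0 ≤ R / N := by positivity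
  have h5 : R / N + R / N + |(t : ℝ)| * (R / N + R / N) ≤ Q / N := by
    calc R / N + R / N + |(t : ℝ)| * (R / N + R / N) = (2 + 2 * |(t : ℝ)|) * (R / N) := by ring
      _ ≤ (2 + 2 * T) * (R / N) := by gcongr
      _ = ((2 + 2 * T) * R) / N := by ring
      _ ≤ Q / N := by gcongr
  linarith

/-- A bracket-linear form is rarely close to an integer. -/
theorem card_bracket_le {x z β R Q : ℝ} {N K : ℕ} {ξ : ℤ} (hN : 0 < N) (hK : 0 < K) (hξ : ξ ≠ 0)
    (hR : 0 ≤ R) (hnr : NonRat x z N Q) (hQ₁ : |(ξ : ℝ)| * (1 + 8 * K ^ 2) ≤ Q)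
    (hQ₂ : (2 + 16 * K ^ 2) * R ≤ Q) (hQ₃ : 112 * (K : ℝ) ^ 3 ≤ Q) {H : Finset ℤ}
    (hHN : H ⊆ Finset.Ioo (-(N : ℤ)) N)
    (hH : ∀ h ∈ H, ‖((ξ * (x * Int.fract (h * z) -
      z * Int.fract (h * x)) + β : ℝ) : UnitAddCircle)‖ ≤ R / N) :
    (H.card : ℝ) ≤ 34 * N / K := by
  have hK' : (1 : ℝ) ≤ K := by exact_mod_cast hK
  have hN' : (0 : ℝ) < N := by exact_mod_cast hN
  have hKK : (K : ℝ) ^ 2 ≤ K ^ 3 := by nlinarith [pow_pos (by linarith : (0 : ℝ) < K) 2]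
  have hKK1 : (K : ℝ) ≤ K ^ 2 := by nlinarith
  have hQ : 0 < Q := by nlinarith
  -- The distance to the integers is at most 1/2, so irrationality already forces N to be large.
  -- This makes the block length l below positive.
  have hNQ : 2 * Q < N := by
    have h1 := hnr 1 0 (Or.inl one_ne_zero) (by simp; nlinarith) (by simp; exact hQ.le)
    have h2 := h1.trans_le (norm_coe_le_half _)
    rw [div_lt_iff₀ hN'] at h2
    linarith
  -- T is the largest multiplier t produced by the pigeonhole. With blocks of length l = ⌊N/T⌋,
  -- multiplying a difference within a block by at most T stays below N in size, while N < 2Tl lets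
  -- 4T blocks cover (−N, N).
  set T : ℕ := 8 * K ^ 2 with hT
  have hT' : (T : ℝ) = 8 * K ^ 2 := by rw [hT]; push_cast; ring
  have hT0 : 0 < T := by positivity
  have hTN : T ≤ N := by
    have : (T : ℝ) ≤ N := by rw [hT']; linarith
    exact_mod_cast this
  set l : ℕ := N / T with hl
  have hl0 : 0 < l := Nat.div_pos hTN hT0
  have hl1 : T * l ≤ N := Nat.mul_div_le N T
  have hl2 : N < 2 * (T * l) := by
    have := Nat.lt_mul_div_succ N hT0
    rw [← hl] at this
    nlinarith
  by_cases hd : ∃ h₁ ∈ H, ∃ h₂ ∈ H, h₁ / (l : ℤ) = h₂ / l ∧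
      1 / (8 * K) ≤ |Int.fract (h₁ * x) - Int.fract (h₂ * x)|
  · obtain ⟨h₁, hh₁, h₂, hh₂, hc, hfr⟩ := hd
    by_contra! hcard
    have hlz : (0 : ℤ) < l := by exact_mod_cast hl0
    have hdl : |h₁ - h₂| ≤ l := by
      have e1 := Int.mul_ediv_add_emod h₁ l
      have e2 := Int.mul_ediv_add_emod h₂ l
      have b1 := Int.emod_nonneg h₁ hlz.ne'
      have b2 := Int.emod_nonneg h₂ hlz.ne'
      have b3 := Int.emod_lt_of_pos h₁ hlz
      have b4 := Int.emod_lt_of_pos h₂ hlz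
      rw [hc] at e1
      rw [abs_le]; constructor <;> linarith
    -- The sums h + 8Ki(h₁ − h₂) with 0 ≤ i ≤ K all lie in [−2N, 2N], which has 4N + 1 elements. A
    -- collision has distinct i, i', and the factor 8K then lifts a gap of 1/(8K) between fractional
    -- parts to at least 1.
    have hpig : (Finset.Icc (-(2 * N : ℤ)) (2 * N)).card < (H ×ˢ Finset.range (K + 1)).card := by
      rw [Finset.card_product, Finset.card_range, Int.card_Icc]
      have h1 : (34 : ℝ) * N < H.card * (K + 1) := by
        rw [div_lt_iff₀ (by linarith)] at hcard
        nlinarith [(Nat.cast_nonneg H.card : (0 : ℝ) ≤ H.card)]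
      have h2 : 34 * N < H.card * (K + 1) := by exact_mod_cast h1
      omega
    obtain ⟨⟨h, i⟩, hp, ⟨h', i'⟩, hp', hne, heq⟩ :=
      Finset.exists_ne_map_eq_of_card_lt_of_maps_to hpig
        (f := fun p : ℤ × ℕ => p.1 + p.2 * (8 * K) * (h₁ - h₂)) (by
        rintro ⟨h, i⟩ hp
        simp only [Finset.coe_product, Set.mem_prod, Finset.mem_coe, Finset.mem_range] at hp
        have hb := Finset.mem_Ioo.1 (hHN hp.1)
        have hi : (i : ℤ) ≤ K := by omega
        have h1 : |(i : ℤ) * (8 * K) * (h₁ - h₂)| ≤ N := by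
          rw [abs_mul, abs_of_nonneg (by positivity : (0 : ℤ) ≤ (i : ℤ) * (8 * K))]
          calc (i : ℤ) * (8 * K) * |h₁ - h₂| ≤ K * (8 * K) * l := by gcongr
            _ = T * l := by rw [hT]; push_cast; ring
            _ ≤ N := by exact_mod_cast hl1
        rw [abs_le] at h1
        simp only [Finset.coe_Icc, Set.mem_Icc]
        constructor <;> linarith)
    simp only [Finset.mem_product, Finset.mem_range] at hp hp' heq
    have hii : i ≠ i' := by
      rintro rfl
      apply hne
      have : h = h' := by linarith
      rw [this]
    have ht : h - h' = (((i' : ℤ) - i) * (8 * K)) * (h₁ - h₂) := by linear_combination heq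
    have h1 : (1 : ℝ) ≤ |((i' : ℤ) : ℝ) - (i : ℤ)| := by
      have : (1 : ℤ) ≤ |(i' : ℤ) - i| := Int.one_le_abs (by omega)
      exact_mod_cast this
    have h2 : |((i' : ℤ) : ℝ) - (i : ℤ)| ≤ K := by
      have : |(i' : ℤ) - i| ≤ K := by rw [abs_le]; omega
      exact_mod_cast this
    have htr : |((((i' : ℤ) - i) * (8 * K) : ℤ) : ℝ)| = |((i' : ℤ) : ℝ) - (i : ℤ)| * (8 * K) := by
      push_cast
      rw [abs_mul, abs_of_nonneg (by positivity : (0 : ℝ) ≤ 8 * (K : ℝ))]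
    refine not_nonRat_of_carry (β := β) (T := 8 * K ^ 2) hξ hR hQ₁ (by linarith) ht ?_ ?_ ?_ hnr
    · rw [htr]; nlinarith
    · rw [htr]
      calc (1 : ℝ) = 1 * (8 * K) * (1 / (8 * K)) := by field_simp
        _ ≤ _ := by gcongr
    · intro k hk
      simp only [Finset.mem_insert, Finset.mem_singleton] at hk
      rcases hk with rfl | rfl | rfl | rfl
      · exact hH _ hp.1
      · exact hH _ hp'.1
      · exact hH _ hh₁
      · exact hH _ hh₂
  -- Here {hx} varies by less than 1/(8K) within each block, so each of the 4T blocks holds at most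
  -- 4l/K + 2N/Q elements. The total is at most 16N/K + 64K²N/Q, and Q ≥ 112K³ absorbs the second
  -- term.
  · push Not at hd
    have hlz : (0 : ℤ) < l := by exact_mod_cast hl0
    have hmaps : ∀ h ∈ H, h / (l : ℤ) ∈ Finset.Ico (-(2 * T : ℤ)) (2 * T) := by
      intro h hh
      have hb := Finset.mem_Ioo.1 (hHN hh)
      have h3 : (N : ℤ) < 2 * (T * l) := by exact_mod_cast hl2
      rw [Finset.mem_Ico]
      constructor
      · rw [Int.le_ediv_iff_mul_le hlz]; linarith
      · rw [Int.ediv_lt_iff_lt_mul hlz]; linarith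
    have hfib : ∀ q ∈ Finset.Ico (-(2 * T : ℤ)) (2 * T),
        (({h ∈ H | h / (l : ℤ) = q} : Finset ℤ).card : ℝ) ≤ 4 * l / K + 2 * N / Q := by
      intro q _
      have hsub : ({h ∈ H | h / (l : ℤ) = q} : Finset ℤ) ⊆ Finset.Icc (q * l) (q * l + l - 1) := by
        intro h hh
        rw [Finset.mem_filter] at hh
        have e1 := Int.mul_ediv_add_emod h l
        have b1 := Int.emod_nonneg h hlz.ne'
        have b3 := Int.emod_lt_of_pos h hlz
        rw [hh.2] at e1
        rw [Finset.mem_Icc]; constructor <;> linarith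
      have := card_le_of_fract_close hK hN hQ (x := x) (fun k hk hkK => by
        have := hnr k 0 (Or.inl hk) (hkK.trans (by linarith)) (by simp; exact hQ.le)
        simpa using this) hsub (by
        intro h hh h' hh'
        rw [Finset.mem_filter] at hh hh'
        exact (hd h hh.1 h' hh'.1 (hh.2.trans hh'.2.symm)).le)
      rw [Int.card_Icc] at this
      have e : (q * l + l - 1 + 1 - q * l : ℤ) = l := by ring
      rw [e, Int.toNat_natCast] at this
      exact this
    rw [Finset.card_eq_sum_card_fiberwise (f := fun h => h / (l : ℤ)) hmaps]
    push_cast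
    refine (Finset.sum_le_sum hfib).trans ?_
    rw [Finset.sum_const, Int.card_Ico, nsmul_eq_mul]
    have e : (2 * T - -(2 * T) : ℤ).toNat = 4 * T := by omega
    rw [e]
    push_cast
    have hl1' : (T : ℝ) * l ≤ N := by exact_mod_cast hl1
    have h5 : 4 * (T : ℝ) * (4 * l / K) ≤ 16 * N / K := by
      rw [mul_div_assoc', div_le_div_iff_of_pos_right (by linarith)]; linarith
    have h6 : 4 * (T : ℝ) * (2 * N / Q) ≤ N / K := by
      rw [hT', mul_div_assoc', div_le_div_iff₀ hQ (by linarith)]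
      nlinarith
    have h7 : 16 * (N : ℝ) / K + N / K ≤ 34 * N / K := by
      rw [← add_div]; gcongr; linarith
    linarith

/-! ### The centre and Lipschitz functions for the left action. -/

/-- The central one-parameter subgroup. -/
def cen (c : ℝ) : Heis := ⟨0, c, 0⟩

@[simp] theorem cen_x (c : ℝ) : (cen c).x = 0 := rfl
@[simp] theorem cen_y (c : ℝ) : (cen c).y = c := rfl
@[simp] theorem cen_z (c : ℝ) : (cen c).z = 0 := rfl

theorem cen_mul_comm (c : ℝ) (g : Heis) : cen c * g = g * cen c := by
  ext <;> simp; ring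

theorem cen_add (c d : ℝ) : cen (c + d) = cen c * cen d := by ext <;> simp

theorem cen_int_mem (n : ℤ) : cen n ∈ Γ := ⟨⟨0, by simp⟩, ⟨n, rfl⟩, ⟨0, by simp⟩⟩

theorem smul_mk (u g : Heis) : u • (QuotientGroup.mk g : Nil) = QuotientGroup.mk (u * g) := rfl

theorem cen_smul_comm (c : ℝ) (g : Heis) (p : Nil) : cen c • g • p = g • cen c • p := by
  rw [smul_smul, cen_mul_comm, ← smul_smul]

theorem cen_add_int_smul (c : ℝ) (n : ℤ) (p : Nil) : cen (c + n) • p = cen c • p := by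
  induction p using QuotientGroup.induction_on with
  | H g =>
    rw [smul_mk, smul_mk, QuotientGroup.eq, cen_add]
    have : (cen c * cen n * g)⁻¹ * (cen c * g) = (cen n)⁻¹ := by
      rw [mul_assoc, cen_mul_comm n g, ← mul_assoc]; group
    rw [this]
    exact Γ.inv_mem (cen_int_mem n)

theorem norm_psi_le {u : Heis} {r : ℝ} (hr : 0 ≤ r) (h1 : |u.x| ≤ r) (h2 : |u.z| ≤ r)
    (h3 : |u.y - u.x * u.z| ≤ r) : ‖psi u‖ ≤ r := by
  rw [pi_norm_le_iff_of_nonneg hr]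
  intro i
  fin_cases i
  · exact h1
  · exact h2
  · exact h3

theorem abs_x_le_norm_psi (u : Heis) : |u.x| ≤ ‖psi u‖ := norm_le_pi_norm (psi u) 0
theorem abs_z_le_norm_psi (u : Heis) : |u.z| ≤ ‖psi u‖ := norm_le_pi_norm (psi u) 1
theorem abs_y_sub_le_norm_psi (u : Heis) : |u.y - u.x * u.z| ≤ ‖psi u‖ :=
  norm_le_pi_norm (psi u) 2

theorem norm_psi_cen_le (c : ℝ) : ‖psi (cen c)‖ ≤ |c| :=
  norm_psi_le (abs_nonneg c) (by simp) (by simp) (by simp)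

/-- Conjugation fixes the first two Mal'cev coordinates and adds b.x u.z − b.z u.x to the third,
hence the factor 1 + 1 + 1. -/
theorem norm_psi_conj_le {b : Heis} (hx : |b.x| ≤ 1) (hz : |b.z| ≤ 1) (u : Heis) :
    ‖psi (b * u * b⁻¹)‖ ≤ 3 * ‖psi u‖ := by
  have h1 := abs_x_le_norm_psi u
  have h2 := abs_z_le_norm_psi u
  have h3 := abs_y_sub_le_norm_psi u
  have h0 := norm_nonneg (psi u)
  refine norm_psi_le (by positivity) (by simp; linarith) (by simp; linarith) ?_
  have e : (b * u * b⁻¹).y - (b * u * b⁻¹).x * (b * u * b⁻¹).z =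
      (u.y - u.x * u.z) + (b.x * u.z - b.z * u.x) := by simp; ring
  rw [e]
  have h4 : |b.x * u.z| ≤ ‖psi u‖ := by rw [abs_mul]; nlinarith [abs_nonneg u.z, abs_nonneg b.x]
  have h5 : |b.z * u.x| ≤ ‖psi u‖ := by rw [abs_mul]; nlinarith [abs_nonneg u.x, abs_nonneg b.z]
  have h6 := abs_add_le (u.y - u.x * u.z) (b.x * u.z - b.z * u.x)
  have h7 := abs_sub (b.x * u.z) (b.z * u.x)
  linarith

theorem continuous_psi : Continuous psi := by
  refine continuous_pi fun i => ?_
  fin_cases i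
  · exact continuous_x
  · exact continuous_z
  · exact continuous_y.sub (continuous_x.mul continuous_z)

/-- Lipschitz functions with respect to the left action of the Heisenberg group. -/
def SMulLip (L : ℝ) (F : Nil → ℂ) : Prop := ∀ (u : Heis) (p : Nil), ‖F (u • p) - F p‖ ≤ L * ‖psi u‖

theorem continuous_of_comp_mk {F : Nil → ℂ}
    (h : Continuous fun g : Heis => F (QuotientGroup.mk g)) : Continuous F :=
  (QuotientGroup.isQuotientMap_mk (N := Γ)).continuous_iff.2 h

theorem SMulLip.continuous {L : ℝ} {F : Nil → ℂ} (hF : SMulLip L F) : Continuous F := by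
  refine continuous_of_comp_mk (continuous_iff_continuousAt.2 fun g => ?_)
  rw [ContinuousAt, tendsto_iff_norm_sub_tendsto_zero]
  have h1 : Filter.Tendsto (fun h : Heis => L * ‖psi (h * g⁻¹)‖) (nhds g) (nhds 0) := by
    have h2 : Continuous fun h : Heis => L * ‖psi (h * g⁻¹)‖ := by
      have := continuous_psi
      fun_prop
    have h3 := h2.tendsto g
    have h4 : psi 1 = 0 := by
      funext i; fin_cases i <;> simp [psi]
    simpa [h4] using h3
  refine squeeze_zero (fun _ => norm_nonneg _) (fun h => ?_) h1
  have := hF (h * g⁻¹) (QuotientGroup.mk g)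
  rwa [smul_mk, inv_mul_cancel_right] at this

theorem continuous_cen_smul {F : Nil → ℂ} (hF : Continuous F) (p : Nil) :
    Continuous fun c : ℝ => F (cen c • p) := by
  induction p using QuotientGroup.induction_on with
  | H g =>
    refine hF.comp (QuotientGroup.continuous_mk.comp ?_)
    have h : Continuous cen :=
      continuous_of_entries continuous_const continuous_id continuous_const
    exact h.mul continuous_const

theorem integrable_of_continuous {F : Nil → ℂ} (hF : Continuous F) {B : ℝ} (hB : ∀ p, ‖F p‖ ≤ B) :
    Integrable F nilHaar :=
  Integrable.of_bound hF.aestronglyMeasurable B (Filter.Eventually.of_forall hB)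

/-- Invariance of Haar measure makes the integral equal to its own negative. A translation by half a
period of a nontrivial character is always available. -/
theorem integral_eq_zero_of_smul_eq_neg {F : Nil → ℂ} (u : Heis) (hF : ∀ p, F (u • p) = -F p) :
    ∫ p, F p ∂nilHaar = 0 := by
  have h := integral_smul_eq_self (μ := nilHaar) F (g := u)
  simp_rw [hF] at h
  rw [integral_neg] at h
  exact self_eq_neg.1 h.symm

/-! ### Fourier decomposition along the centre. -/

/-- The component of `F` on which the centre acts by the character of frequency `ξ`. -/
def vert (ξ : ℤ) (F : Nil → ℂ) (p : Nil) : ℂ := ∫ c in (0 : ℝ)..1, F (cen c • p) * ee (-(ξ * c))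

section vert

variable {F : Nil → ℂ}

theorem continuous_vert_integrand (ξ : ℤ) (hF : Continuous F) (p : Nil) :
    Continuous fun c : ℝ => F (cen c • p) * ee (-(ξ * c)) :=
  (continuous_cen_smul hF p).mul (continuous_ee.comp (by fun_prop))

theorem norm_vert_le (ξ : ℤ) {B : ℝ} (hB : ∀ p, ‖F p‖ ≤ B) (p : Nil) : ‖vert ξ F p‖ ≤ B := by
  have := intervalIntegral.norm_integral_le_of_norm_le_const (a := 0) (b := 1) (C := B)
    (f := fun c : ℝ => F (cen c • p) * ee (-(ξ * c))) (fun c _ => by simpa using hB _)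
  simpa [vert] using this

theorem SMulLip.vert {L : ℝ} (ξ : ℤ) (hF : SMulLip L F) : SMulLip L (vert ξ F) := by
  intro u p
  rw [Heis.vert, Heis.vert, ← intervalIntegral.integral_sub
    ((continuous_vert_integrand ξ hF.continuous _).intervalIntegrable _ _)
    ((continuous_vert_integrand ξ hF.continuous _).intervalIntegrable _ _)]
  have := intervalIntegral.norm_integral_le_of_norm_le_const (a := 0) (b := 1) (C := L * ‖psi u‖)
    (f := fun c : ℝ => F (cen c • u • p) * ee (-(ξ * c)) - F (cen c • p) * ee (-(ξ * c)))
    (fun c _ => by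
      rw [← sub_mul, norm_mul, norm_ee, mul_one, cen_smul_comm]
      exact hF _ _)
  simpa using this

/-- The integrand has period 1 because integer central elements act trivially on G/Γ, so the
integral over a shifted period is unchanged and only the phase remains. -/
theorem vert_cen_smul (ξ : ℤ) (d : ℝ) (p : Nil) :
    vert ξ F (cen d • p) = ee (ξ * d) * vert ξ F p := by
  set f : ℝ → ℂ := fun c => F (cen c • p) * ee (-(ξ * c)) with hf
  have hper : Function.Periodic f 1 := by
    intro c
    have h1 := cen_add_int_smul c 1 p
    have h2 : -(ξ * (c + 1) : ℝ) = -(ξ * c) + ((-ξ : ℤ) : ℝ) := by push_cast; ring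
    rw [Int.cast_one] at h1
    simp only [hf]
    rw [h1, h2, ee_add_int]
  have h1 : vert ξ F (cen d • p) = ∫ c in (0 : ℝ)..1, ee (ξ * d) * f (c + d) := by
    rw [vert]
    congr 1
    funext c
    simp only [hf]
    rw [smul_smul, ← cen_add, mul_left_comm, ← ee_add]
    congr 2; ring
  rw [h1, intervalIntegral.integral_const_mul, intervalIntegral.integral_comp_add_right]
  have h2 := hper.intervalIntegral_add_eq (0 + d) 0
  rw [add_right_comm, zero_add] at h2
  rw [zero_add, add_comm 1 d]
  simp only [zero_add] at h2
  rw [add_comm 1 d] at h2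
  rw [h2]
  rfl

theorem integral_vert_eq_zero {ξ : ℤ} (hξ : ξ ≠ 0) : ∫ p, vert ξ F p ∂nilHaar = 0 := by
  refine integral_eq_zero_of_smul_eq_neg (cen (1 / (2 * ξ))) fun p => ?_
  have h : (ξ : ℝ) * (1 / (2 * ξ)) = 1 / 2 := by
    have : (ξ : ℝ) ≠ 0 := by exact_mod_cast hξ
    field_simp
  rw [vert_cen_smul, h, ee_half, neg_one_mul]

/-- Fejér summation along the centre. -/
theorem norm_sub_sum_vert_le (hF : SMulLip 1 F) {m : ℕ} (hm : 0 < m) (p : Nil) :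
    ‖F p - ∑ ξ ∈ Finset.Ioo (-(m : ℤ)) m, (fejerCoeff m ξ : ℂ) * vert (-ξ) F p‖ ≤ 1 / √m := by
  have hfc := continuous_fejer m
  have hcc := continuous_cen_smul hF.continuous p
  -- The kernel contributes e(ξc), whereas `vert` integrates against e(−ξc); hence the index −ξ.
  have h1 : ∑ ξ ∈ Finset.Ioo (-(m : ℤ)) m, (fejerCoeff m ξ : ℂ) * vert (-ξ) F p =
      ∫ c in (0 : ℝ)..1, F (cen c • p) * fejer m c := by
    simp_rw [fejer_eq_sum_fejerCoeff, Finset.mul_sum]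
    rw [intervalIntegral.integral_finsetSum]
    · refine Finset.sum_congr rfl fun ξ _ => ?_
      rw [vert, ← intervalIntegral.integral_const_mul]
      congr 1; funext c
      rw [mul_left_comm]; congr 3; push_cast; ring
    · intro ξ _
      exact (hcc.mul (continuous_const.mul
        (continuous_ee.comp (by fun_prop)))).intervalIntegrable _ _
  have h2 : F p = ∫ c in (0 : ℝ)..1, F p * fejer m c := by
    rw [intervalIntegral.integral_const_mul, intervalIntegral.integral_ofReal, integral_fejer m hm]
    simp
  have hofr : Continuous fun c : ℝ => (fejer m c : ℂ) := Complex.continuous_ofReal.comp hfc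
  rw [h1]
  nth_rewrite 1 [h2]
  have hi₁ : IntervalIntegrable (fun c : ℝ => F p * fejer m c) volume 0 1 :=
    (continuous_const.mul hofr).intervalIntegrable _ _
  have hi₂ : IntervalIntegrable (fun c : ℝ => F (cen c • p) * fejer m c) volume 0 1 :=
    (hcc.mul hofr).intervalIntegrable _ _
  rw [← intervalIntegral.integral_sub hi₁ hi₂]
  have h3 : ∀ c : ℝ, ‖F p * fejer m c - F (cen c • p) * fejer m c‖ ≤
      (fejer m c + 1) / (2 * √m) := by
    intro c
    rw [← sub_mul, norm_mul, Complex.norm_real, Real.norm_of_nonneg (fejer_nonneg m c), mul_comm]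
    refine le_trans ?_ (fejer_mul_norm_le hm c)
    refine mul_le_mul_of_nonneg_left ?_ (fejer_nonneg m c)
    -- Replace c by its representative nearest 0, so that the displacement is measured by the circle
    -- norm of c.
    have h4 := cen_add_int_smul (c - round c) (round c) p
    rw [sub_add_cancel] at h4
    rw [norm_sub_rev, h4, UnitAddCircle.norm_eq]
    exact (hF _ _).trans ((one_mul _).trans_le (norm_psi_cen_le _))
  refine (intervalIntegral.norm_integral_le_of_norm_le zero_le_one
    (Filter.Eventually.of_forall fun c _ => h3 c)
    (Continuous.intervalIntegrable (by fun_prop) _ _)).trans ?_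
  rw [intervalIntegral.integral_div, intervalIntegral.integral_add
    (hfc.intervalIntegrable _ _) (continuous_const.intervalIntegrable _ _), integral_fejer m hm]
  have hm' : (0 : ℝ) < √m := Real.sqrt_pos.2 (by exact_mod_cast hm)
  simp
  apply le_of_eq; field_simp; norm_num

end vert

/-! ### Trigonometric approximation of centre-invariant functions. -/

section torus

variable {Φ : Nil → ℂ} {L : ℝ}

/-- A function invariant under the centre is a Lipschitz function on the torus. -/
theorem norm_sub_le_of_cen_invariant (hL : 0 ≤ L) (hΦ : SMulLip L Φ)
    (hc : ∀ c p, Φ (cen c • p) = Φ p)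
    (g g' : Heis) : ‖Φ (QuotientGroup.mk g) - Φ (QuotientGroup.mk g')‖ ≤
      L * (‖((g.x - g'.x : ℝ) : UnitAddCircle)‖ + ‖((g.z - g'.z : ℝ) : UnitAddCircle)‖) := by
  set m := round (g.x - g'.x) with hm
  set n := round (g.z - g'.z) with hn
  set γ : Heis := ⟨(-m : ℤ), 0, (-n : ℤ)⟩ with hγ
  have hγΓ : γ ∈ Γ := ⟨⟨_, rfl⟩, ⟨0, by simp [hγ]⟩, ⟨_, rfl⟩⟩
  -- The integer element γ reduces the x and z displacements to their representatives nearest 0. The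
  -- third Mal'cev coordinate s of u is then removed by the central factor `cen (-s)`, to which Φ is
  -- blind.
  set u := g * γ * g'⁻¹ with hu
  set s := u.y - u.x * u.z with hs
  have h1 : (QuotientGroup.mk g : Nil) = u • (QuotientGroup.mk g' : Nil) := by
    rw [smul_mk, hu, inv_mul_cancel_right, QuotientGroup.eq]
    simpa using hγΓ
  have h2 := hΦ (cen (-s) * u) (QuotientGroup.mk g')
  rw [← smul_smul, hc, ← h1] at h2
  refine h2.trans (mul_le_mul_of_nonneg_left ?_ hL)
  have hx : (cen (-s) * u).x = g.x - g'.x - m := by simp [hu, hγ]; ring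
  have hz : (cen (-s) * u).z = g.z - g'.z - n := by simp [hu, hγ]; ring
  rw [UnitAddCircle.norm_eq, UnitAddCircle.norm_eq]
  refine norm_psi_le (by positivity) ?_ ?_ ?_
  · rw [hx]; linarith [abs_nonneg (g.z - g'.z - n)]
  · rw [hz]; linarith [abs_nonneg (g.x - g'.x - m)]
  · have : (cen (-s) * u).y - (cen (-s) * u).x * (cen (-s) * u).z = 0 := by
      simp [hs]
    rw [this, abs_zero]
    positivity

theorem sum_fejer_mul_norm_le {M : ℕ} (hM : 0 < M) (t : ℝ) :
    ∑ a ∈ Finset.range M, fejer M (t - a / M) * ‖((t - a / M : ℝ) : UnitAddCircle)‖ ≤ M / √M := by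
  have hM' : (0 : ℝ) < √M := Real.sqrt_pos.2 (by exact_mod_cast hM)
  calc _ ≤ ∑ a ∈ Finset.range M, (fejer M (t - a / M) + 1) / (2 * √M) :=
        Finset.sum_le_sum fun a _ => fejer_mul_norm_le hM _
    _ = M / √M := by
        rw [← Finset.sum_div, Finset.sum_add_distrib, sum_fejer M hM]
        simp only [Finset.sum_const, Finset.card_range, nsmul_eq_mul, mul_one]
        rw [← two_mul, mul_div_mul_left _ _ two_ne_zero]

/-- Approximation of centre-invariant Lipschitz functions by trigonometric polynomials. -/
theorem exists_trig_approx {B : ℝ} (hL : 0 ≤ L) (hΦ : SMulLip L Φ) (hB : ∀ p, ‖Φ p‖ ≤ B)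
    (hc : ∀ c p, Φ (cen c • p) = Φ p) {M : ℕ} (hM : 0 < M) :
    ∃ C : ℤ → ℤ → ℂ, (∀ k l, ‖C k l‖ ≤ B) ∧ ∀ g : Heis,
      ‖Φ (QuotientGroup.mk g) - ∑ k ∈ Finset.Ioo (-(M : ℤ)) M, ∑ l ∈ Finset.Ioo (-(M : ℤ)) M,
        C k l * ee (k * g.x + l * g.z)‖ ≤ 2 * L / √M := by
  have hM' : (0 : ℝ) < M := by exact_mod_cast hM
  have hMC : (M : ℂ) ≠ 0 := by exact_mod_cast hM.ne'
  have hB0 : 0 ≤ B := (norm_nonneg _).trans (hB (QuotientGroup.mk 1))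
  set φ : ℕ → ℕ → ℂ := fun a b => Φ (QuotientGroup.mk ⟨a / M, 0, b / M⟩) with hφ
  -- These are the coefficients of a discrete Fejér convolution with samples of Φ at M-th fractions.
  -- The translated kernels sum exactly to M in each variable, so no integral over the torus is
  -- needed.
  refine ⟨fun k l => fejerCoeff M k * fejerCoeff M l * ((∑ a ∈ Finset.range M,
    ∑ b ∈ Finset.range M, φ a b * ee (-(k * (a / M) + l * (b / M)))) / M ^ 2), ?_, ?_⟩
  · intro k l
    rw [norm_mul, norm_mul, Complex.norm_real, Complex.norm_real,
      Real.norm_of_nonneg (fejerCoeff_nonneg _ _), Real.norm_of_nonneg (fejerCoeff_nonneg _ _),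
      norm_div, norm_pow, Complex.norm_natCast]
    have h1 : ‖∑ a ∈ Finset.range M, ∑ b ∈ Finset.range M,
        φ a b * ee (-(k * (a / M) + l * (b / M)))‖ / M ^ 2 ≤ B := by
      rw [div_le_iff₀ (by positivity)]
      calc _ ≤ ∑ a ∈ Finset.range M, ∑ b ∈ Finset.range M, B := by
            refine (norm_sum_le _ _).trans (Finset.sum_le_sum fun a _ => ?_)
            refine (norm_sum_le _ _).trans (Finset.sum_le_sum fun b _ => ?_)
            rw [norm_mul, norm_ee, mul_one]; exact hB _
        _ = B * M ^ 2 := by simp; ring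
    have h2 : fejerCoeff M k * fejerCoeff M l ≤ 1 :=
      mul_le_one₀ (fejerCoeff_le_one _ _) (fejerCoeff_nonneg _ _) (fejerCoeff_le_one _ _)
    exact (mul_le_mul h2 h1 (by positivity) zero_le_one).trans_eq (one_mul B)
  · intro g
    set W : ℕ → ℕ → ℝ := fun a b => fejer M (g.x - a / M) * fejer M (g.z - b / M) with hW
    have e1 : ∑ k ∈ Finset.Ioo (-(M : ℤ)) M, ∑ l ∈ Finset.Ioo (-(M : ℤ)) M,
        fejerCoeff M k * fejerCoeff M l * ((∑ a ∈ Finset.range M,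
        ∑ b ∈ Finset.range M, φ a b * ee (-(k * (a / M) + l * (b / M)))) / M ^ 2) *
        ee (k * g.x + l * g.z) =
        (∑ a ∈ Finset.range M, ∑ b ∈ Finset.range M, φ a b * W a b) / M ^ 2 := by
      have e2 : ∀ a b : ℕ, φ a b * W a b = ∑ k ∈ Finset.Ioo (-(M : ℤ)) M,
          ∑ l ∈ Finset.Ioo (-(M : ℤ)) M, fejerCoeff M k * fejerCoeff M l *
            (φ a b * ee (-(k * (a / M) + l * (b / M)))) * ee (k * g.x + l * g.z) := by
        intro a b
        simp only [hW]
        rw [Complex.ofReal_mul, fejer_eq_sum_fejerCoeff, fejer_eq_sum_fejerCoeff,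
          Finset.sum_mul_sum, Finset.mul_sum]
        refine Finset.sum_congr rfl fun k _ => ?_
        rw [Finset.mul_sum]
        refine Finset.sum_congr rfl fun l _ => ?_
        have : ee (-(k * (a / M) + l * (b / M))) * ee (k * g.x + l * g.z) =
            ee (k * (g.x - a / M)) * ee (l * (g.z - b / M)) := by
          rw [← ee_add, ← ee_add]; congr 1; ring
        linear_combination -(fejerCoeff M k * fejerCoeff M l * φ a b) * this
      simp_rw [e2]
      rw [Finset.sum_div]
      simp_rw [Finset.sum_div, Finset.mul_sum, Finset.sum_mul]
      have hswap : ∀ f : ℕ → ℕ → ℤ → ℤ → ℂ, ∑ a ∈ Finset.range M, ∑ b ∈ Finset.range M,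
          ∑ k ∈ Finset.Ioo (-(M : ℤ)) M, ∑ l ∈ Finset.Ioo (-(M : ℤ)) M, f a b k l =
          ∑ k ∈ Finset.Ioo (-(M : ℤ)) M, ∑ l ∈ Finset.Ioo (-(M : ℤ)) M,
          ∑ a ∈ Finset.range M, ∑ b ∈ Finset.range M, f a b k l := by
        intro f
        rw [Finset.sum_congr rfl fun a _ => Finset.sum_comm, Finset.sum_comm]
        refine Finset.sum_congr rfl fun k _ => ?_
        rw [Finset.sum_congr rfl fun a _ => Finset.sum_comm, Finset.sum_comm]
      rw [hswap]
      refine Finset.sum_congr rfl fun k _ => Finset.sum_congr rfl fun l _ =>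
        Finset.sum_congr rfl fun a _ => Finset.sum_congr rfl fun b _ => ?_
      ring
    rw [e1]
    have e3 : ∑ a ∈ Finset.range M, ∑ b ∈ Finset.range M, W a b = (M : ℝ) ^ 2 := by
      simp only [hW]
      rw [← Finset.sum_mul_sum, sum_fejer M hM, sum_fejer M hM]; ring
    have e4 : Φ (QuotientGroup.mk g) - (∑ a ∈ Finset.range M, ∑ b ∈ Finset.range M,
        φ a b * W a b) / M ^ 2 = (∑ a ∈ Finset.range M, ∑ b ∈ Finset.range M,
        (Φ (QuotientGroup.mk g) - φ a b) * W a b) / M ^ 2 := by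
      have e5 : ((∑ a ∈ Finset.range M, ∑ b ∈ Finset.range M, W a b : ℝ) : ℂ) = (M : ℂ) ^ 2 := by
        rw [e3]; push_cast; rfl
      push_cast at e5
      simp_rw [sub_mul, Finset.sum_sub_distrib, ← Finset.mul_sum]
      rw [e5]; field_simp
    rw [e4, norm_div, norm_pow, Complex.norm_natCast, div_le_iff₀ (by positivity)]
    have hW0 : ∀ a b, 0 ≤ W a b := fun a b => mul_nonneg (fejer_nonneg _ _) (fejer_nonneg _ _)
    calc _ ≤ ∑ a ∈ Finset.range M, ∑ b ∈ Finset.range M,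
          (L * (‖((g.x - a / M : ℝ) : UnitAddCircle)‖ +
            ‖((g.z - b / M : ℝ) : UnitAddCircle)‖)) * W a b := by
          refine (norm_sum_le _ _).trans (Finset.sum_le_sum fun a _ => ?_)
          refine (norm_sum_le _ _).trans (Finset.sum_le_sum fun b _ => ?_)
          rw [norm_mul, Complex.norm_real, Real.norm_of_nonneg (hW0 a b)]
          refine mul_le_mul_of_nonneg_right ?_ (hW0 a b)
          exact norm_sub_le_of_cen_invariant hL hΦ hc _ _
      _ = L * ((∑ a ∈ Finset.range M, fejer M (g.x - a / M) *
            ‖((g.x - a / M : ℝ) : UnitAddCircle)‖) * (∑ b ∈ Finset.range M, fejer M (g.z - b / M)) +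
          (∑ a ∈ Finset.range M, fejer M (g.x - a / M)) * (∑ b ∈ Finset.range M,
            fejer M (g.z - b / M) * ‖((g.z - b / M : ℝ) : UnitAddCircle)‖)) := by
          rw [Finset.sum_mul_sum, Finset.sum_mul_sum, ← Finset.sum_add_distrib, Finset.mul_sum]
          refine Finset.sum_congr rfl fun a _ => ?_
          rw [← Finset.sum_add_distrib, Finset.mul_sum]
          refine Finset.sum_congr rfl fun b _ => ?_
          simp only [hW]; ring
      _ ≤ L * (M / √M * M + M * (M / √M)) := by
          rw [sum_fejer M hM, sum_fejer M hM]
          have h1 := sum_fejer_mul_norm_le hM g.x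
          have h2 := sum_fejer_mul_norm_le hM g.z
          gcongr
      _ = 2 * L / √M * M ^ 2 := by ring

end torus

/-! ### Orbits, horizontal characters as functions, and equidistribution on the torus. -/

theorem zpow_x (a : Heis) (n : ℤ) : (a ^ n).x = n * a.x := by
  induction n using Int.induction_on with
  | zero => simp
  | succ n ih => rw [zpow_add_one, mul_x, ih]; push_cast; ring
  | pred n ih => rw [zpow_sub_one, mul_x, ih, inv_x]; push_cast; ring

theorem zpow_z (a : Heis) (n : ℤ) : (a ^ n).z = n * a.z := by
  induction n using Int.induction_on with
  | zero => simp
  | succ n ih => rw [zpow_add_one, mul_z, ih]; push_cast; ring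
  | pred n ih => rw [zpow_sub_one, mul_z, ih, inv_z]; push_cast; ring

/-- The commutator of a^n and b is central and bilinear, hence linear in n; it is the source of the
linear phase in the autocorrelations. -/
theorem zpow_mul_eq (a b : Heis) (n : ℤ) :
    a ^ n * b = cen (n * (a.x * b.z - a.z * b.x)) * (b * a ^ n) := by
  ext
  · simp; ring
  · simp [zpow_x, zpow_z]; ring
  · simp; ring

/-- The character `(x, z) ↦ e(kx + lz)` as a function on the nilmanifold. -/
def chi (k l : ℤ) (p : Nil) : ℂ := ee (k * p.out.x + l * p.out.z)

theorem chi_mk (k l : ℤ) (g : Heis) : chi k l (QuotientGroup.mk g) = ee (k * g.x + l * g.z) := by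
  have h : (QuotientGroup.mk (QuotientGroup.mk g : Nil).out : Nil) = QuotientGroup.mk g :=
    Quotient.out_eq _
  rw [chi]
  set o := (QuotientGroup.mk g : Nil).out
  rw [QuotientGroup.eq] at h
  obtain ⟨⟨m, hm⟩, -, ⟨n, hn⟩⟩ := h
  rw [mul_x, inv_x] at hm
  rw [mul_z, inv_z] at hn
  have : (k * g.x + l * g.z : ℝ) = k * o.x + l * o.z + ((k * m + l * n : ℤ) : ℝ) := by
    push_cast; rw [← hm, ← hn]; ring
  rw [this, ee_add_int]

theorem norm_chi (k l : ℤ) (p : Nil) : ‖chi k l p‖ = 1 := norm_ee _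

theorem integrable_chi (k l : ℤ) : Integrable (chi k l) nilHaar := by
  refine integrable_of_continuous (continuous_of_comp_mk ?_) fun p => (norm_chi k l p).le
  simp_rw [chi_mk]
  have := continuous_x
  have := continuous_z
  exact continuous_ee.comp (by fun_prop)

theorem integral_chi_zero : ∫ p, chi 0 0 p ∂nilHaar = 1 := by
  simp [chi]

theorem integral_chi {k l : ℤ} (h : k ≠ 0 ∨ l ≠ 0) : ∫ p, chi k l p ∂nilHaar = 0 := by
  have hs : ∀ u g : Heis, chi k l (u • (QuotientGroup.mk g : Nil)) =
      ee (k * u.x + l * u.z) * chi k l (QuotientGroup.mk g) := by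
    intro u g
    rw [smul_mk, chi_mk, chi_mk, ← ee_add]; congr 1; simp; ring
  obtain ⟨u, hu⟩ : ∃ u : Heis, (k * u.x + l * u.z : ℝ) = 1 / 2 := by
    rcases h with h | h
    · have : (k : ℝ) ≠ 0 := by exact_mod_cast h
      exact ⟨⟨1 / (2 * k), 0, 0⟩, by simp; field_simp⟩
    · have : (l : ℝ) ≠ 0 := by exact_mod_cast h
      exact ⟨⟨0, 0, 1 / (2 * l)⟩, by simp; field_simp⟩
  refine integral_eq_zero_of_smul_eq_neg u fun p => ?_
  induction p using QuotientGroup.induction_on with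
  | H g => rw [hs, hu, ee_half, neg_one_mul]

theorem card_Ioo_neg_le (M : ℕ) : ((Finset.Ioo (-(M : ℤ)) M).card : ℝ) ≤ 2 * M := by
  rw [Int.card_Ioo]
  have : ((M : ℤ) - -(M : ℤ) - 1).toNat ≤ 2 * M := by omega
  exact_mod_cast this

theorem norm_sum_sum_le {M : ℕ} {D : ℝ} (hD : 0 ≤ D) {f : ℤ → ℤ → ℂ}
    (hf : ∀ k ∈ Finset.Ioo (-(M : ℤ)) M, ∀ l ∈ Finset.Ioo (-(M : ℤ)) M, ‖f k l‖ ≤ D) :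
    ‖∑ k ∈ Finset.Ioo (-(M : ℤ)) M, ∑ l ∈ Finset.Ioo (-(M : ℤ)) M, f k l‖ ≤ 4 * M ^ 2 * D := by
  have hc := card_Ioo_neg_le M
  calc _ ≤ ∑ k ∈ Finset.Ioo (-(M : ℤ)) M, ∑ l ∈ Finset.Ioo (-(M : ℤ)) M, D := by
        refine (norm_sum_le _ _).trans (Finset.sum_le_sum fun k hk => ?_)
        exact (norm_sum_le _ _).trans (Finset.sum_le_sum fun l hl => hf k hk l hl)
    _ = ((Finset.Ioo (-(M : ℤ)) M).card : ℝ) * ((Finset.Ioo (-(M : ℤ)) M).card * D) := by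
        simp only [Finset.sum_const, nsmul_eq_mul]
    _ ≤ 2 * M * (2 * M * D) := by gcongr
    _ = _ := by ring

theorem norm_sum_ee_le {u v : ℤ} {t r : ℝ} (hr : 0 < r) (ht : r ≤ ‖(t : UnitAddCircle)‖) :
    ‖∑ n ∈ Finset.Icc u v, ee (n * t)‖ ≤ 1 / (2 * r) := by
  have h := norm_Icc_sum_ee_mul_le u v t
  rw [le_div_iff₀ (by positivity)]
  nlinarith [norm_nonneg (∑ n ∈ Finset.Icc u v, ee (n * t))]

theorem norm_integral_sub_le {F G : Nil → ℂ} (hF : Integrable F nilHaar)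
    (hG : Integrable G nilHaar) {r : ℝ} (h : ∀ p, ‖F p - G p‖ ≤ r) :
    ‖∫ p, F p ∂nilHaar - ∫ p, G p ∂nilHaar‖ ≤ r := by
  rw [← integral_sub hF hG]
  have := norm_integral_le_of_norm_le_const (μ := nilHaar) (Filter.Eventually.of_forall h)
  simpa using this

theorem norm_avg_sub_le {N : ℕ} (hN : 0 < N) {f g : ℤ → ℂ} {r : ℝ} (h : ∀ n, ‖f n - g n‖ ≤ r) :
    ‖(∑ n ∈ Finset.Icc (1 : ℤ) N, f n) / (N : ℂ) - (∑ n ∈ Finset.Icc (1 : ℤ) N, g n) / (N : ℂ)‖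
      ≤ r := by
  have hN' : (0 : ℝ) < N := by exact_mod_cast hN
  rw [← sub_div, ← Finset.sum_sub_distrib, norm_div, Complex.norm_natCast, div_le_iff₀ hN']
  refine (norm_sum_le_of_le _ fun n _ => h n).trans ?_
  simp [mul_comm]

theorem sub_bound_of_approx {A I A' I' : ℂ} {r s : ℝ} (h1 : ‖A - A'‖ ≤ r) (h2 : ‖I - I'‖ ≤ r)
    (h3 : ‖A' - I'‖ ≤ s) : ‖A - I‖ ≤ 2 * r + s := by
  have e : A - I = (A - A') + (A' - I') - (I - I') := by ring
  rw [e]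
  have := norm_sub_le ((A - A') + (A' - I')) (I - I')
  have := norm_add_le (A - A') (A' - I')
  linarith

/-- Equidistribution for functions on the horizontal torus. -/
theorem norm_avg_sub_integral_le_of_cen_invariant {a : Heis} {N M : ℕ} {Q : ℝ} (hN : 0 < N)
    (hM : 0 < M) (hMQ : M ≤ Q) (hnr : NonRat a.x a.z N Q) {Φ : Nil → ℂ} (hB : ∀ p, ‖Φ p‖ ≤ 1)
    (hΦ : SMulLip 1 Φ) (hc : ∀ c p, Φ (cen c • p) = Φ p) :
    ‖(∑ n ∈ Finset.Icc (1 : ℤ) N, Φ (QuotientGroup.mk (a ^ n))) / (N : ℂ) - ∫ p, Φ p ∂nilHaar‖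
      ≤ 2 * (2 / √M) + 2 * M ^ 2 / Q := by
  have hN' : (0 : ℝ) < N := by exact_mod_cast hN
  have hM' : (0 : ℝ) < M := by exact_mod_cast hM
  have hQ : 0 < Q := by linarith
  obtain ⟨C, hC, happ⟩ := exists_trig_approx zero_le_one hΦ hB hc hM
  rw [mul_one] at happ
  set I := Finset.Ioo (-(M : ℤ)) M with hI
  have h0 : (0 : ℤ) ∈ I := by simp [hI, hM]
  set P : Nil → ℂ := fun p => ∑ k ∈ I, ∑ l ∈ I, C k l * chi k l p with hP
  have hint : Integrable P nilHaar :=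
    integrable_finsetSum _ fun k _ => integrable_finsetSum _ fun l _ =>
      (integrable_chi k l).const_mul _
  have hclose : ∀ p, ‖Φ p - P p‖ ≤ 2 / √M := by
    intro p
    induction p using QuotientGroup.induction_on with
    | H g => simpa only [hP, chi_mk] using happ g
  refine sub_bound_of_approx (norm_avg_sub_le hN fun n => hclose _)
    (norm_integral_sub_le (integrable_of_continuous hΦ.continuous hB) hint hclose) ?_
  have e1 : ∫ p, P p ∂nilHaar = ∑ k ∈ I, ∑ l ∈ I, C k l * ∫ p, chi k l p ∂nilHaar := by
    simp only [hP]
    rw [integral_finsetSum _ fun k _ => integrable_finsetSum _ fun l _ =>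
      (integrable_chi k l).const_mul _]
    refine Finset.sum_congr rfl fun k _ => ?_
    rw [integral_finsetSum _ fun l _ => (integrable_chi k l).const_mul _]
    refine Finset.sum_congr rfl fun l _ => ?_
    rw [integral_const_mul]
  have e2 : (∑ n ∈ Finset.Icc (1 : ℤ) N, P (QuotientGroup.mk (a ^ n))) / (N : ℂ) =
      ∑ k ∈ I, ∑ l ∈ I, C k l *
        ((∑ n ∈ Finset.Icc (1 : ℤ) N, ee (n * (k * a.x + l * a.z))) / N) := by
    simp only [hP, chi_mk, zpow_x, zpow_z]
    rw [Finset.sum_comm, Finset.sum_div]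
    refine Finset.sum_congr rfl fun k _ => ?_
    rw [Finset.sum_comm, Finset.sum_div]
    refine Finset.sum_congr rfl fun l _ => ?_
    rw [← Finset.mul_sum, mul_div_assoc]
    congr 2
    refine Finset.sum_congr rfl fun n _ => ?_
    congr 1; ring
  rw [e1, e2, ← Finset.sum_sub_distrib]
  simp_rw [← Finset.sum_sub_distrib, ← mul_sub]
  -- There are at most 4M² frequencies; the zero one is exact, and each other one has orbit average
  -- at most 1/(2Q) and integral zero.
  have e3 : 2 * (M : ℝ) ^ 2 / Q = 4 * M ^ 2 * (1 / (2 * Q)) := by field_simp; ring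
  rw [e3]
  refine norm_sum_sum_le (by positivity) fun k hk l hl => ?_
  rw [norm_mul]
  refine (mul_le_mul_of_nonneg_right (hC k l) (norm_nonneg _)).trans ?_
  rw [one_mul]
  by_cases hkl : k = 0 ∧ l = 0
  · obtain ⟨rfl, rfl⟩ := hkl
    rw [integral_chi_zero]
    have : (N : ℂ) ≠ 0 := by exact_mod_cast hN.ne'
    simp [this]
    positivity
  · have hkl' : k ≠ 0 ∨ l ≠ 0 := by tauto
    rw [integral_chi hkl', sub_zero, norm_div, Complex.norm_natCast, div_le_iff₀ hN']
    have hb : ∀ j ∈ I, |(j : ℝ)| ≤ Q := by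
      intro j hj
      have := abs_lt.2 (Finset.mem_Ioo.1 hj)
      have : |(j : ℝ)| < M := by exact_mod_cast this
      linarith
    have := norm_sum_ee_le (u := 1) (v := N) (by positivity)
      (hnr k l hkl' (hb k hk) (hb l hl)).le
    refine this.trans_eq ?_
    field_simp

/-! ### Van der Corput's argument for nonzero vertical frequency. -/

/-- Bound for a horizontal function twisted by a linear phase. -/
theorem norm_twisted_sum_le {a : Heis} {N M : ℕ} (hM : 0 < M) {Φ : Nil → ℂ} {L D r : ℝ}
    (hL : 0 ≤ L) (hD : 0 ≤ D) (hB : ∀ p, ‖Φ p‖ ≤ 1) (hΦ : SMulLip L Φ)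
    (hc : ∀ c p, Φ (cen c • p) = Φ p)
    {u v : ℤ} (huv : (Finset.Icc u v).card ≤ N)
    (hexp : ∀ k ∈ Finset.Ioo (-(M : ℤ)) M, ∀ l ∈ Finset.Ioo (-(M : ℤ)) M,
      ‖∑ n ∈ Finset.Icc u v, ee (n * (r + (k * a.x + l * a.z)))‖ ≤ D) :
    ‖∑ n ∈ Finset.Icc u v, ee (n * r) * Φ (QuotientGroup.mk (a ^ n))‖ ≤
      N * (2 * L / √M) + 4 * M ^ 2 * D := by
  obtain ⟨C, hC, happ⟩ := exists_trig_approx hL hΦ hB hc hM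
  set I := Finset.Ioo (-(M : ℤ)) M with hI
  set P : ℤ → ℂ := fun n => ∑ k ∈ I, ∑ l ∈ I, C k l * ee (k * (a ^ n).x + l * (a ^ n).z) with hP
  have e1 : ∑ n ∈ Finset.Icc u v, ee (n * r) * Φ (QuotientGroup.mk (a ^ n)) =
      ∑ n ∈ Finset.Icc u v, ee (n * r) * (Φ (QuotientGroup.mk (a ^ n)) - P n) +
      ∑ k ∈ I, ∑ l ∈ I, C k l *
        ∑ n ∈ Finset.Icc u v, ee (n * (r + (k * a.x + l * a.z))) := by
    simp_rw [mul_sub]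
    rw [Finset.sum_sub_distrib]
    have : ∑ n ∈ Finset.Icc u v, ee (n * r) * P n = ∑ k ∈ I, ∑ l ∈ I, C k l *
        ∑ n ∈ Finset.Icc u v, ee (n * (r + (k * a.x + l * a.z))) := by
      simp only [hP, Finset.mul_sum, zpow_x, zpow_z]
      rw [Finset.sum_comm]
      refine Finset.sum_congr rfl fun k _ => ?_
      rw [Finset.sum_comm]
      refine Finset.sum_congr rfl fun l _ => Finset.sum_congr rfl fun n _ => ?_
      rw [mul_left_comm, ← ee_add]
      congr 2; ring
    rw [this, sub_add_cancel]
  rw [e1]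
  refine (norm_add_le _ _).trans (add_le_add ?_ ?_)
  · refine (norm_sum_le_of_le _ (f := fun n : ℤ => ee (n * r) * (Φ (QuotientGroup.mk (a ^ n)) - P n))
      (n := fun _ => 2 * L / √M) fun n _ => ?_).trans ?_
    · rw [norm_mul, norm_ee, one_mul]
      exact happ _
    · rw [Finset.sum_const, nsmul_eq_mul]
      have : ((Finset.Icc u v).card : ℝ) ≤ N := by exact_mod_cast huv
      gcongr
  · refine norm_sum_sum_le hD fun k hk l hl => ?_
    rw [norm_mul]
    exact (mul_le_mul (hC k l) (hexp k hk l hl) (norm_nonneg _) zero_le_one).trans_eq (one_mul D)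

/-- The square of a sum as a sum of autocorrelations. -/
theorem sum_mul_star_sum (c : ℤ → ℂ) (N : ℕ) :
    (∑ n ∈ Finset.Icc (1 : ℤ) N, c n) * star (∑ n ∈ Finset.Icc (1 : ℤ) N, c n) =
      ∑ h ∈ Finset.Ioo (-(N : ℤ)) N, ∑ n ∈ Finset.Icc (max 1 (1 - h)) (min (N : ℤ) (N - h)),
        c (n + h) * star (c n) := by
  rw [star_sum, Finset.sum_mul_sum, ← Finset.sum_product', ← Finset.sum_fiberwise_of_maps_to
    (t := Finset.Ioo (-(N : ℤ)) N) (g := fun p : ℤ × ℤ => p.1 - p.2)]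
  · refine Finset.sum_congr rfl fun h _ => ?_
    -- A pair of indices with difference h is determined by the smaller-weight entry n; requiring
    -- both n and n + h in [1, N] gives the max and min in the range.
    refine Finset.sum_nbij' (fun p => p.2) (fun n => (n + h, n)) ?_ ?_ ?_ ?_ ?_
    · rintro ⟨m, n⟩ hp
      simp only [Finset.mem_filter, Finset.mem_product, Finset.mem_Icc] at hp ⊢
      omega
    · intro n hn
      simp only [Finset.mem_filter, Finset.mem_product, Finset.mem_Icc] at hn ⊢
      omega
    · rintro ⟨m, n⟩ hp
      simp only [Finset.mem_filter, Finset.mem_product, Finset.mem_Icc] at hp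
      ext
      · simp only; omega
      · rfl
    · intro n _; rfl
    · rintro ⟨m, n⟩ hp
      simp only [Finset.mem_filter, Finset.mem_product, Finset.mem_Icc] at hp
      have : m = n + h := by omega
      rw [this]
  · rintro ⟨m, n⟩ hp
    simp only [Finset.mem_product, Finset.mem_Icc, Finset.mem_Ioo] at hp ⊢
    omega

section correlation

variable {f : Nil → ℂ} {ξ : ℤ}

/-- The correlation of a function of vertical frequency `ξ` with its translate is a horizontal
function. -/
theorem correlation_cen_smul (hξ : ∀ c p, f (cen c • p) = ee (ξ * c) * f p) (b : Heis) (c : ℝ)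
    (p : Nil) : f (b • cen c • p) * star (f (cen c • p)) = f (b • p) * star (f p) := by
  rw [← cen_smul_comm, hξ, hξ, star_mul, star_ee]
  have : ee (ξ * c) * ee (-(ξ * c)) = 1 := by rw [← ee_add, add_neg_cancel, ee_zero]
  linear_combination f (b • p) * star (f p) * this

/-- Since bup = (bub⁻¹)bp, the translated factor has Lipschitz constant 3 for b with bounded
horizontal part, and the conjugated factor adds 1. -/
theorem smulLip_correlation (hB : ∀ p, ‖f p‖ ≤ 1) (hf : SMulLip 1 f) {b : Heis} (hx : |b.x| ≤ 1)
    (hz : |b.z| ≤ 1) : SMulLip 4 fun p => f (b • p) * star (f p) := by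
  intro u p
  have h1 := hf u p
  have h2 := hf (b * u * b⁻¹) (b • p)
  rw [smul_smul, inv_mul_cancel_right, ← smul_smul] at h2
  have h3 := norm_psi_conj_le hx hz u
  have e : f (b • u • p) * star (f (u • p)) - f (b • p) * star (f p) =
      (f (b • u • p) - f (b • p)) * star (f (u • p)) + f (b • p) * star (f (u • p) - f p) := by
    rw [star_sub]; ring
  simp only [e]
  refine (norm_add_le _ _).trans ?_
  rw [norm_mul, norm_mul, norm_star, norm_star]
  have h4 := mul_le_mul h2 (hB (u • p)) (norm_nonneg _) (by positivity)
  have h5 := mul_le_mul (hB (b • p)) h1 (norm_nonneg _) zero_le_one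
  linarith

/-- The entry y is left uncontrolled: only x and z enter the commutator and the Lipschitz constant
of the correlation. -/
theorem exists_fract_representative (g : Heis) : ∃ b : Heis, b.x = Int.fract g.x ∧
    b.z = Int.fract g.z ∧ (QuotientGroup.mk g : Nil) = QuotientGroup.mk b := by
  refine ⟨g * ⟨(-⌊g.x⌋ : ℤ), 0, (-⌊g.z⌋ : ℤ)⟩, ?_, ?_, ?_⟩
  · rw [mul_x, Int.fract]; push_cast; ring
  · rw [mul_z, Int.fract]; push_cast; ring
  · rw [QuotientGroup.eq, inv_mul_cancel_left]
    exact ⟨⟨_, rfl⟩, ⟨0, by simp⟩, ⟨_, rfl⟩⟩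

/-- Writing a^hΓ = bΓ with the horizontal part of b in [0, 1)² keeps the correlation function
4-Lipschitz uniformly in h. The price is that the commutator phase contains the fractional parts of
ha.x and ha.z. -/
theorem norm_autocorrelation_le {a : Heis} {N M : ℕ} {h : ℤ} {D : ℝ} (hM : 0 < M) (hD : 0 ≤ D)
    (hB : ∀ p, ‖f p‖ ≤ 1) (hf : SMulLip 1 f) (hξ : ∀ c p, f (cen c • p) = ee (ξ * c) * f p)
    {u v : ℤ} (huv : (Finset.Icc u v).card ≤ N)
    (hexp : ∀ k ∈ Finset.Ioo (-(M : ℤ)) M, ∀ l ∈ Finset.Ioo (-(M : ℤ)) M,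
      ‖∑ n ∈ Finset.Icc u v, ee (n * (ξ * (a.x * Int.fract (h * a.z) -
        a.z * Int.fract (h * a.x)) + (k * a.x + l * a.z)))‖ ≤ D) :
    ‖∑ n ∈ Finset.Icc u v, f (QuotientGroup.mk (a ^ (n + h))) *
      star (f (QuotientGroup.mk (a ^ n)))‖ ≤ N * (8 / √M) + 4 * M ^ 2 * D := by
  obtain ⟨b, hbx, hbz, hb⟩ := exists_fract_representative (a ^ h)
  rw [zpow_x] at hbx
  rw [zpow_z] at hbz
  have habs : ∀ t : ℝ, |Int.fract t| ≤ 1 := fun t => by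
    rw [abs_of_nonneg (Int.fract_nonneg t)]; exact (Int.fract_lt_one t).le
  have e1 : ∀ n : ℤ, f (QuotientGroup.mk (a ^ (n + h))) =
      ee (n * (ξ * (a.x * Int.fract (h * a.z) - a.z * Int.fract (h * a.x)))) *
        f (b • (QuotientGroup.mk (a ^ n) : Nil)) := by
    intro n
    rw [zpow_add, ← smul_mk, hb, smul_mk, zpow_mul_eq, ← smul_mk, hξ, smul_mk, hbx, hbz]
    congr 2; ring
  simp_rw [e1, mul_assoc]
  have h2 := norm_twisted_sum_le (a := a) (N := N) hM (L := 4) (by norm_num) hD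
    (Φ := fun p => f (b • p) * star (f p)) (fun p => by
      rw [norm_mul, norm_star]
      exact mul_le_one₀ (hB _) (norm_nonneg _) (hB _))
    (smulLip_correlation hB hf (by rw [hbx]; exact habs _) (by rw [hbz]; exact habs _))
    (fun c p => correlation_cen_smul hξ b c p) huv hexp
  rw [show (2 * 4 : ℝ) = 8 by norm_num] at h2
  exact h2.trans_eq (by ring)

/-- Functions of nonzero vertical frequency have small averages along the orbit. -/
theorem norm_sq_sum_le_of_frequency_ne_zero {a : Heis} {N M : ℕ} {Q : ℝ} (hN : 0 < N) (hM : 0 < M)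
    (hξ0 : ξ ≠ 0) (hξM : |(ξ : ℝ)| ≤ M) (hQ : Q = 112 * M ^ 9) (hnr : NonRat a.x a.z N Q)
    (hB : ∀ p, ‖f p‖ ≤ 1) (hf : SMulLip 1 f) (hξ : ∀ c p, f (cen c • p) = ee (ξ * c) * f p) :
    ‖∑ n ∈ Finset.Icc (1 : ℤ) N, f (QuotientGroup.mk (a ^ n))‖ ^ 2 ≤ 156 * N ^ 2 / √M := by
  have hN' : (0 : ℝ) < N := by exact_mod_cast hN
  have hM' : (1 : ℝ) ≤ M := by exact_mod_cast hM
  set I := Finset.Ioo (-(M : ℤ)) M with hI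
  set S : ℤ → ℂ := fun h => ∑ n ∈ Finset.Icc (max 1 (1 - h)) (min (N : ℤ) (N - h)),
    f (QuotientGroup.mk (a ^ (n + h))) * star (f (QuotientGroup.mk (a ^ n))) with hS
  have hcard : ∀ h : ℤ, (Finset.Icc (max 1 (1 - h)) (min (N : ℤ) (N - h))).card ≤ N := by
    intro h; rw [Int.card_Icc]; omega
  set θ : ℤ → ℝ := fun h => ξ * (a.x * Int.fract (h * a.z) - a.z * Int.fract (h * a.x)) with hθ
  set bad : ℤ → ℤ → Finset ℤ := fun k l => {h ∈ Finset.Ioo (-(N : ℤ)) N |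
    ‖((θ h + (k * a.x + l * a.z) : ℝ) : UnitAddCircle)‖ ≤ (M : ℝ) ^ 3 / N} with hbad
  set Bad := I.biUnion fun k => I.biUnion fun l => bad k l with hBad
  have hp3 : (1 : ℝ) ≤ (M : ℝ) ^ 3 := one_le_pow₀ hM'
  have hp6 : (1 : ℝ) ≤ (M : ℝ) ^ 6 := one_le_pow₀ hM'
  have hbadcard : ∀ k l, ((bad k l).card : ℝ) ≤ 34 * N / M ^ 3 := by
    intro k l
    -- With K = M³, the union over at most 4M² pairs (k, l) still has only O(N/M) elements; with R =
    -- M³, each good exponential sum is at most N/(2M³), so 4M² of them contribute 2N/M. The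
    -- condition 112K³ ≤ Q holds with equality.
    have := card_bracket_le (K := M ^ 3) (R := M ^ 3) (β := k * a.x + l * a.z)
      (H := bad k l) hN (by positivity) hξ0 (by positivity) hnr ?_ ?_ ?_ ?_ ?_
    · exact_mod_cast this
    · rw [hQ]; push_cast
      calc |(ξ : ℝ)| * (1 + 8 * ((M : ℝ) ^ 3) ^ 2) ≤
          M * ((M : ℝ) ^ 6 + 8 * ((M : ℝ) ^ 3) ^ 2) := by gcongr
        _ = 9 * (M : ℝ) ^ 7 := by ring
        _ ≤ 112 * (M : ℝ) ^ 9 := by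
          gcongr
          · norm_num
          · norm_num
    · rw [hQ]; push_cast
      have : (M : ℝ) ^ 9 = (M ^ 6) * M ^ 3 := by ring
      rw [this]
      nlinarith [mul_nonneg (sub_nonneg.2 hp6) (by linarith : (0 : ℝ) ≤ M ^ 3)]
    · rw [hQ]; push_cast; apply le_of_eq; ring
    · exact Finset.filter_subset _ _
    · intro h hh
      exact (Finset.mem_filter.1 hh).2
  have hBadcard : (Bad.card : ℝ) ≤ 136 * N / M := by
    have hc := card_Ioo_neg_le M
    have h1 : Bad.card ≤ ∑ k ∈ I, ∑ l ∈ I, (bad k l).card :=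
      Finset.card_biUnion_le.trans (Finset.sum_le_sum fun k _ => Finset.card_biUnion_le)
    have h2 : (Bad.card : ℝ) ≤ ∑ k ∈ I, ∑ l ∈ I, ((bad k l).card : ℝ) := by exact_mod_cast h1
    calc (Bad.card : ℝ) ≤ ∑ k ∈ I, ∑ l ∈ I, (34 * N / M ^ 3 : ℝ) :=
          h2.trans (Finset.sum_le_sum fun k _ => Finset.sum_le_sum fun l _ => hbadcard k l)
      _ = I.card * (I.card * (34 * N / M ^ 3)) := by
          simp only [Finset.sum_const, nsmul_eq_mul]
      _ ≤ 2 * M * (2 * M * (34 * N / M ^ 3)) := by gcongr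
      _ = 136 * N / M := by field_simp; norm_num
  have htriv : ∀ h, ‖S h‖ ≤ N := by
    intro h
    refine (norm_sum_le_of_le _ (n := fun _ => (1 : ℝ)) fun n _ => ?_).trans ?_
    · rw [norm_mul, norm_star]
      exact mul_le_one₀ (hB _) (norm_nonneg _) (hB _)
    · simp only [Finset.sum_const, nsmul_eq_mul, mul_one]
      exact_mod_cast hcard h
  have hgood : ∀ h ∈ Finset.Ioo (-(N : ℤ)) N, h ∉ Bad → ‖S h‖ ≤ N * (8 / √M) + 2 * N / M := by
    intro h hh hhb
    have h1 := norm_autocorrelation_le (a := a) (N := N) (h := h) (D := N / (2 * M ^ 3)) hM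
      (by positivity) hB hf hξ (hcard h) (fun k hk l hl => by
        have h2 : (M : ℝ) ^ 3 / N < ‖((θ h + (k * a.x + l * a.z) : ℝ) : UnitAddCircle)‖ := by
          by_contra! hcon
          apply hhb
          rw [hBad, Finset.mem_biUnion]
          refine ⟨k, hk, Finset.mem_biUnion.2 ⟨l, hl, ?_⟩⟩
          exact Finset.mem_filter.2 ⟨hh, hcon⟩
        refine (norm_sum_ee_le (by positivity) h2.le).trans_eq ?_
        field_simp)
    refine h1.trans_eq ?_
    congr 1
    field_simp; norm_num
  have hsq : ‖∑ n ∈ Finset.Icc (1 : ℤ) N, f (QuotientGroup.mk (a ^ n))‖ ^ 2 =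
      ‖∑ h ∈ Finset.Ioo (-(N : ℤ)) N, S h‖ := by
    rw [← sum_mul_star_sum (fun n => f (QuotientGroup.mk (a ^ n))), norm_mul, norm_star, sq]
  have hr0 : 0 < √(M : ℝ) := Real.sqrt_pos.2 (by linarith)
  have hrM : 1 / (M : ℝ) ≤ 1 / √M := by
    apply one_div_le_one_div_of_le hr0
    rw [Real.sqrt_le_left (by linarith)]
    nlinarith
  rw [hsq]
  calc ‖∑ h ∈ Finset.Ioo (-(N : ℤ)) N, S h‖
      ≤ ∑ h ∈ Finset.Ioo (-(N : ℤ)) N, ((N * (8 / √M) + 2 * N / M) +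
        if h ∈ Bad then (N : ℝ) else 0) := by
        refine norm_sum_le_of_le _ fun h hh => ?_
        by_cases hb : h ∈ Bad
        · rw [if_pos hb]
          have : 0 ≤ N * (8 / √(M : ℝ)) + 2 * N / M := by positivity
          linarith [htriv h]
        · rw [if_neg hb, add_zero]; exact hgood h hh hb
    _ ≤ 2 * N * (N * (8 / √M) + 2 * N / M) + 136 * N / M * N := by
        rw [Finset.sum_add_distrib, ← Finset.sum_filter, Finset.sum_const, Finset.sum_const,
          nsmul_eq_mul, nsmul_eq_mul]
        have h1 := card_Ioo_neg_le N
        have h2 : (({h ∈ Finset.Ioo (-(N : ℤ)) N | h ∈ Bad} : Finset ℤ).card : ℝ) ≤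
            136 * N / M := by
          refine le_trans ?_ hBadcard
          exact_mod_cast Finset.card_le_card fun h hh => (Finset.mem_filter.1 hh).2
        gcongr
    _ = (N : ℝ) ^ 2 * (16 * (1 / √M) + 140 * (1 / M)) := by ring
    _ ≤ (N : ℝ) ^ 2 * (16 * (1 / √M) + 140 * (1 / √M)) := by gcongr
    _ = 156 * N ^ 2 / √M := by ring

end correlation

/-! ### Combining the vertical frequencies. -/

/-- Quantitative equidistribution of a horizontally irrational orbit. -/
theorem norm_avg_sub_integral_le {a : Heis} {N m : ℕ} (hN : 0 < N) (hm : 0 < m)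
    (hnr : NonRat a.x a.z N (112 * ((m : ℝ) ^ 12) ^ 9)) {F : Nil → ℂ} (hB : ∀ p, ‖F p‖ ≤ 1)
    (hF : SMulLip 1 F) :
    ‖(∑ n ∈ Finset.Icc (1 : ℤ) N, F (QuotientGroup.mk (a ^ n))) / (N : ℂ) - ∫ p, F p ∂nilHaar‖
      ≤ 28 / √m := by
  have hN' : (0 : ℝ) < N := by exact_mod_cast hN
  have hNC : (N : ℂ) ≠ 0 := by exact_mod_cast hN.ne'
  have hm' : (1 : ℝ) ≤ m := by exact_mod_cast hm
  -- Then √M = m⁶, and the square root of the van der Corput bound is of order m⁻³, enough to sum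
  -- over the fewer than 2m vertical frequencies.
  set M : ℕ := m ^ 12 with hM
  have hM0 : 0 < M := by positivity
  have hMr : (M : ℝ) = (m : ℝ) ^ 12 := by rw [hM]; push_cast; rfl
  have hM1 : (1 : ℝ) ≤ M := by exact_mod_cast hM0
  have hsM : √(M : ℝ) = (m : ℝ) ^ 6 := by
    rw [hMr, show (m : ℝ) ^ 12 = ((m : ℝ) ^ 6) ^ 2 by ring, Real.sqrt_sq (by positivity)]
  rw [← hMr] at hnr
  have hM9 : (M : ℝ) ≤ M ^ 9 := le_self_pow₀ hM1 (by norm_num)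
  set I := Finset.Ioo (-(m : ℤ)) m with hI
  have hcont : ∀ ξ, Integrable (vert ξ F) nilHaar := fun ξ =>
    integrable_of_continuous (hF.vert ξ).continuous (norm_vert_le ξ hB)
  have hterm : ∀ ξ ∈ I, ‖(∑ n ∈ Finset.Icc (1 : ℤ) N, vert (-ξ) F (QuotientGroup.mk (a ^ n))) /
      (N : ℂ) - ∫ p, vert (-ξ) F p ∂nilHaar‖ ≤ 13 / m ^ 3 := by
    intro ξ hξ
    by_cases h0 : ξ = 0
    · subst h0
      refine (norm_avg_sub_integral_le_of_cen_invariant hN hM0 (by linarith) hnr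
        (norm_vert_le _ hB) (hF.vert _) fun c p => by rw [vert_cen_smul]; simp).trans ?_
      have h1 : 2 * (M : ℝ) ^ 2 / (112 * M ^ 9) ≤ 1 / m ^ 6 := by
        rw [← hsM, div_le_div_iff₀ (by positivity) (by rw [hsM]; positivity)]
        have h2 : √(M : ℝ) ≤ M := by
          rw [Real.sqrt_le_left (by linarith)]; nlinarith
        have h3 : (M : ℝ) ^ 3 ≤ M ^ 9 := pow_le_pow_right₀ hM1 (by norm_num)
        nlinarith [mul_le_mul_of_nonneg_left h2 (sq_nonneg (M : ℝ))]
      have h4 : 1 / (m : ℝ) ^ 6 ≤ 1 / m ^ 3 :=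
        one_div_le_one_div_of_le (by positivity) (pow_le_pow_right₀ hm' (by norm_num))
      have h5 : 0 < 1 / (m : ℝ) ^ 3 := by positivity
      rw [hsM]
      have e1 : 2 * (2 / (m : ℝ) ^ 6) = 4 * (1 / m ^ 6) := by ring
      have e2 : 13 / (m : ℝ) ^ 3 = 13 * (1 / m ^ 3) := by ring
      rw [e1, e2]
      linarith
    · have hn0 : -ξ ≠ 0 := neg_ne_zero.2 h0
      rw [integral_vert_eq_zero hn0, sub_zero, norm_div, Complex.norm_natCast, div_le_iff₀ hN']
      have hξm : |((-ξ : ℤ) : ℝ)| ≤ M := by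
        have h1 := abs_lt.2 (Finset.mem_Ioo.1 hξ)
        have h2 : |(ξ : ℝ)| < m := by exact_mod_cast h1
        have h3 : (m : ℝ) ≤ M := by rw [hMr]; exact le_self_pow₀ hm' (by norm_num)
        push_cast; rw [abs_neg]; linarith
      have h1 := norm_sq_sum_le_of_frequency_ne_zero hN hM0 hn0 hξm rfl hnr (norm_vert_le _ hB)
        (hF.vert _) (fun c p => vert_cen_smul (-ξ) c p)
      rw [hsM] at h1
      -- Compare squares: 156 ≤ 13² = 169.
      refine le_of_sq_le_sq ?_ (by positivity)
      refine h1.trans ?_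
      rw [mul_pow, div_pow, div_mul_eq_mul_div, ← pow_mul]
      norm_num
      gcongr
      norm_num
  set G : Nil → ℂ := fun p => ∑ ξ ∈ I, (fejerCoeff m ξ : ℂ) * vert (-ξ) F p with hG
  have hGint : Integrable G nilHaar :=
    integrable_finsetSum _ fun ξ _ => (hcont _).const_mul _
  have hclose : ∀ p, ‖F p - G p‖ ≤ 1 / √m := fun p => norm_sub_sum_vert_le hF hm p
  have key : ‖(∑ n ∈ Finset.Icc (1 : ℤ) N, G (QuotientGroup.mk (a ^ n))) / (N : ℂ) -
      ∫ p, G p ∂nilHaar‖ ≤ 26 / √m := by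
    have e1 : ∫ p, G p ∂nilHaar =
        ∑ ξ ∈ I, (fejerCoeff m ξ : ℂ) * ∫ p, vert (-ξ) F p ∂nilHaar := by
      simp only [hG]
      rw [integral_finsetSum _ fun ξ _ => (hcont _).const_mul _]
      refine Finset.sum_congr rfl fun ξ _ => ?_
      rw [integral_const_mul]
    have e2 : (∑ n ∈ Finset.Icc (1 : ℤ) N, G (QuotientGroup.mk (a ^ n))) / (N : ℂ) =
        ∑ ξ ∈ I, (fejerCoeff m ξ : ℂ) *
          ((∑ n ∈ Finset.Icc (1 : ℤ) N, vert (-ξ) F (QuotientGroup.mk (a ^ n))) / N) := by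
      simp only [hG]
      rw [Finset.sum_comm, Finset.sum_div]
      refine Finset.sum_congr rfl fun ξ _ => ?_
      rw [← Finset.mul_sum, mul_div_assoc]
    rw [e1, e2, ← Finset.sum_sub_distrib]
    simp_rw [← mul_sub]
    have hc := card_Ioo_neg_le m
    calc _ ≤ ∑ ξ ∈ I, (13 / m ^ 3 : ℝ) := by
          refine norm_sum_le_of_le _ fun ξ hξ => ?_
          rw [norm_mul, Complex.norm_real, Real.norm_of_nonneg (fejerCoeff_nonneg _ _)]
          exact (mul_le_mul (fejerCoeff_le_one _ _) (hterm ξ hξ) (norm_nonneg _)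
            zero_le_one).trans_eq (one_mul _)
      _ = I.card * (13 / m ^ 3 : ℝ) := by rw [Finset.sum_const, nsmul_eq_mul]
      _ ≤ 2 * m * (13 / m ^ 3 : ℝ) := by gcongr
      _ = 26 / m ^ 2 := by field_simp; norm_num
      _ ≤ 26 / √m := by
          have : 0 < √(m : ℝ) := Real.sqrt_pos.2 (by linarith)
          gcongr
          rw [Real.sqrt_le_left (by positivity)]
          nlinarith [one_le_pow₀ hm' (n := 2)]
  refine (sub_bound_of_approx (norm_avg_sub_le hN fun n => hclose _)
    (norm_integral_sub_le (integrable_of_continuous hF.continuous hB) hGint hclose) key).trans_eq ?_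
  ring

/-! ### From the metric and the Lipschitz norm to normalised functions. -/

theorem heisDist_nonneg (x y : Heis) : 0 ≤ heisDist x y := by
  refine Real.sInf_nonneg ?_
  rintro r ⟨n, c, -, -, rfl⟩
  exact Finset.sum_nonneg fun i _ => le_min (norm_nonneg _) (norm_nonneg _)

theorem heisDist_le (x y : Heis) : heisDist x y ≤ ‖psi (x * y⁻¹)‖ := by
  have h : heisDist x y ≤ min ‖psi (x * y⁻¹)‖ ‖psi (y * x⁻¹)‖ := by
    refine csInf_le ⟨0, ?_⟩ ⟨1, fun i => if i = 0 then x else y, by simp, by simp, by simp⟩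
    rintro r ⟨n, c, -, -, rfl⟩
    exact Finset.sum_nonneg fun i _ => le_min (norm_nonneg _) (norm_nonneg _)
  exact h.trans (min_le_left _ _)

theorem nilDist_nonneg (p q : Nil) : 0 ≤ nilDist p q := by
  refine Real.sInf_nonneg ?_
  rintro r ⟨x, y, -, -, rfl⟩
  exact heisDist_nonneg x y

/-- Use the representatives ug and g, for which (ug)g⁻¹ = u. Besides nonnegativity, this upper bound
is the only property of the metric the argument needs. -/
theorem nilDist_smul_le (u : Heis) (p : Nil) : nilDist (u • p) p ≤ ‖psi u‖ := by
  induction p using QuotientGroup.induction_on with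
  | H g =>
    have h : nilDist (u • (QuotientGroup.mk g : Nil)) (QuotientGroup.mk g) ≤ heisDist (u * g) g := by
      refine csInf_le ⟨0, ?_⟩ ⟨u * g, g, rfl, rfl, rfl⟩
      rintro r ⟨x, y, -, -, rfl⟩
      exact heisDist_nonneg x y
    refine h.trans ((heisDist_le _ _).trans_eq ?_)
    rw [mul_inv_cancel_right]

/-- Reduction into the unit cube. This gives the boundedness of Lipschitz functions, without which
the real supremum in `lipNorm` would take a default value. -/
theorem exists_bounded_representative (p : Nil) :
    ∃ b : Heis, ‖psi b‖ ≤ 2 ∧ b • (QuotientGroup.mk 1 : Nil) = p := by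
  induction p using QuotientGroup.induction_on with
  | H g =>
    obtain ⟨b, hx, hz, hb⟩ := exists_fract_representative g
    refine ⟨b * cen (-⌊b.y⌋ : ℤ), ?_, ?_⟩
    · have h1 := Int.fract_nonneg g.x
      have h2 := Int.fract_lt_one g.x
      have h3 := Int.fract_nonneg g.z
      have h4 := Int.fract_lt_one g.z
      have h5 := Int.fract_nonneg b.y
      have h6 := Int.fract_lt_one b.y
      rw [← hx] at h1 h2
      rw [← hz] at h3 h4
      have e1 : (b * cen (-⌊b.y⌋ : ℤ)).x = b.x := by simp
      have e2 : (b * cen (-⌊b.y⌋ : ℤ)).z = b.z := by simp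
      have e3 : (b * cen (-⌊b.y⌋ : ℤ)).y = Int.fract b.y := by
        rw [mul_y, cen_y, cen_z, Int.fract]; push_cast; ring
      refine norm_psi_le two_pos.le ?_ ?_ ?_
      · rw [e1, abs_le]; constructor <;> linarith
      · rw [e2, abs_le]; constructor <;> linarith
      · rw [e1, e2, e3, abs_le]; constructor <;> nlinarith
    · rw [smul_mk, mul_one, hb, eq_comm, QuotientGroup.eq, inv_mul_cancel_left]
      exact cen_int_mem _

theorem IsLipschitz.smulLip {F : Nil → ℂ} {K : ℝ}
    (hK : ∀ p q : Nil, ‖F p - F q‖ ≤ K * nilDist p q) : SMulLip |K| F := by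
  intro u p
  calc ‖F (u • p) - F p‖ ≤ K * nilDist (u • p) p := hK _ _
    _ ≤ |K| * nilDist (u • p) p :=
        mul_le_mul_of_nonneg_right (le_abs_self K) (nilDist_nonneg _ _)
    _ ≤ |K| * ‖psi u‖ := mul_le_mul_of_nonneg_left (nilDist_smul_le u p) (abs_nonneg K)

/-- The Lipschitz norm bounds both the sup norm and the Lipschitz constant. -/
theorem lipNorm_bounds {F : Nil → ℂ} (hF : IsLipschitz F) :
    (∀ p, ‖F p‖ ≤ lipNorm F) ∧ SMulLip (lipNorm F) F := by
  obtain ⟨K, hK⟩ := hF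
  have hS := IsLipschitz.smulLip hK
  have hbdd : BddAbove (Set.range fun p : Nil => ‖F p‖) := by
    refine ⟨|K| * 2 + ‖F (QuotientGroup.mk 1)‖, ?_⟩
    rintro _ ⟨p, rfl⟩
    obtain ⟨b, hb, rfl⟩ := exists_bounded_representative p
    have h1 := hS b (QuotientGroup.mk 1)
    have h2 := mul_le_mul_of_nonneg_left hb (abs_nonneg K)
    have h3 := norm_sub_norm_le (F (b • (QuotientGroup.mk 1 : Nil))) (F (QuotientGroup.mk 1))
    simp only
    linarith
  have hbdd' : BddAbove (Set.range fun pq : {pq : Nil × Nil // pq.1 ≠ pq.2} =>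
      ‖F pq.1.1 - F pq.1.2‖ / nilDist pq.1.1 pq.1.2) := by
    refine ⟨|K|, ?_⟩
    rintro _ ⟨pq, rfl⟩
    -- A vanishing distance is harmless here, since the quotient is then 0.
    refine div_le_of_le_mul₀ (nilDist_nonneg _ _) (abs_nonneg K) ?_
    exact (hK _ _).trans (mul_le_mul_of_nonneg_right (le_abs_self K) (nilDist_nonneg _ _))
  have h1 : 0 ≤ ⨆ p : Nil, ‖F p‖ := Real.iSup_nonneg fun p => norm_nonneg _
  have h2 : 0 ≤ ⨆ pq : {pq : Nil × Nil // pq.1 ≠ pq.2},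
      ‖F pq.1.1 - F pq.1.2‖ / nilDist pq.1.1 pq.1.2 :=
    Real.iSup_nonneg fun pq => div_nonneg (norm_nonneg _) (nilDist_nonneg _ _)
  refine ⟨fun p => (le_ciSup hbdd p).trans (le_add_of_nonneg_right h2), fun u p => ?_⟩
  have hΛ : 0 ≤ lipNorm F := add_nonneg h1 h2
  by_cases hup : u • p = p
  · rw [hup, sub_self, norm_zero]
    exact mul_nonneg hΛ (norm_nonneg _)
  · refine le_trans ?_ (mul_le_mul_of_nonneg_left (nilDist_smul_le u p) hΛ)
    -- That distinct points have positive distance is not needed: at distance 0 the bound with K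
    -- already forces the two values of F to agree.
    rcases (nilDist_nonneg (u • p) p).eq_or_lt with h0 | h0
    · have := hK (u • p) p
      rw [← h0, mul_zero] at this
      rwa [← h0, mul_zero]
    · rw [← div_le_iff₀ h0]
      exact (le_ciSup hbdd' ⟨(u • p, p), hup⟩).trans (le_add_of_nonneg_left h1)

/-- It suffices to test equidistribution on functions of Lipschitz norm one. -/
theorem isEquidistributed_of_normalized {g : ℤ → Heis} {N : ℕ} {δ : ℝ}
    (h : ∀ F : Nil → ℂ, (∀ p, ‖F p‖ ≤ 1) → SMulLip 1 F →
      ‖(∑ n ∈ Finset.Icc (1 : ℤ) N, F (QuotientGroup.mk (g n))) / (N : ℂ) - ∫ p, F p ∂nilHaar‖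
        ≤ δ) : IsEquidistributed g N δ := by
  intro F hF
  obtain ⟨hB, hL⟩ := lipNorm_bounds hF
  set r := lipNorm F
  have hr : 0 ≤ r := (norm_nonneg _).trans (hB (QuotientGroup.mk 1))
  rcases hr.eq_or_lt with h0 | h0
  · have hF0 : ∀ p, F p = 0 := fun p => norm_le_zero_iff.1 (by rw [h0]; exact hB p)
    simp [hF0, ← h0]
  · have hrC : (r : ℂ) ≠ 0 := by exact_mod_cast h0.ne'
    have hn : ‖((r : ℂ)⁻¹)‖ = r⁻¹ := by rw [norm_inv, Complex.norm_real, Real.norm_of_nonneg hr]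
    have key := h (fun p => (r : ℂ)⁻¹ * F p) (fun p => by
        rw [norm_mul, hn, inv_mul_le_iff₀ h0, mul_one]; exact hB p) (fun u p => by
        rw [← mul_sub, norm_mul, hn, inv_mul_le_iff₀ h0, one_mul]; exact hL u p)
    rw [integral_const_mul, ← Finset.mul_sum, mul_div_assoc, ← mul_sub, norm_mul, hn,
      inv_mul_le_iff₀ h0] at key
    rwa [mul_comm]

theorem norm_avg_sub_integral_le_two {g : ℤ → Heis} {N : ℕ} (hN : 0 < N) {F : Nil → ℂ}
    (hB : ∀ p, ‖F p‖ ≤ 1) :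
    ‖(∑ n ∈ Finset.Icc (1 : ℤ) N, F (QuotientGroup.mk (g n))) / (N : ℂ) - ∫ p, F p ∂nilHaar‖
      ≤ 2 := by
  have h1 := norm_avg_sub_le hN (f := fun n => F (QuotientGroup.mk (g n))) (g := fun _ => 0)
    (r := 1) fun n => by rw [sub_zero]; exact hB _
  have h2 := norm_integral_le_of_norm_le_const (μ := nilHaar) (Filter.Eventually.of_forall hB)
  simp only [Finset.sum_const_zero, zero_div, sub_zero] at h1
  simp at h2
  refine (norm_sub_le _ _).trans ?_
  linarith

/-! ### Horizontal characters and the final choice of parameters. -/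

/-- The horizontal character of frequency `(k, l, 0)`. -/
def horizontalCharacter (k l : ℤ) : HorizontalCharacter where
  toFun g := ((k * g.x + l * g.z : ℝ) : UnitAddCircle)
  map_mul' g h := by
    rw [← AddCircle.coe_add]; congr 1; simp; ring
  continuous_toFun := by
    have := continuous_x
    have := continuous_z
    exact (AddCircle.continuous_mk' 1).comp (by fun_prop)
  annihilates := by
    rintro γ ⟨⟨m, hm⟩, -, ⟨n, hn⟩⟩
    rw [hm, hn, AddCircle.coe_eq_zero_iff]
    exact ⟨k * m + l * n, by simp⟩

theorem modulus_horizontalCharacter (k l : ℤ) :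
    (horizontalCharacter k l).modulus = ‖(![k, l, 0] : Fin 3 → ℤ)‖ := by
  refine HorizontalCharacter.modulus_eq fun g => ?_
  simp [horizontalCharacter, psi, Fin.sum_univ_three]

end Heis

end

theorem proposition5p1 :
    ∃ C A : ℝ, 0 < C ∧ 0 < A ∧
      ∀ (a : Heis) (δ : ℝ), 0 < δ → ∀ N : ℕ, 1 ≤ N →
        Heis.IsEquidistributed (fun n : ℤ => a ^ n) N δ ∨
        ∃ η : Heis.HorizontalCharacter,
          0 < η.modulus ∧ η.modulus ≤ C * δ ^ (-A) ∧
          ‖η.toFun a‖ ≤ C * δ ^ (-A) / N := by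
  -- The threshold is Q = 112 m^108 with m ≤ 788/δ², hence the exponent 216.
  refine ⟨112 * 788 ^ 108, 216, by positivity, by norm_num, fun a δ hδ N hN => ?_⟩
  by_cases hδ2 : 2 ≤ δ
  · exact Or.inl (Heis.isEquidistributed_of_normalized fun F hB _ =>
      (Heis.norm_avg_sub_integral_le_two hN hB).trans hδ2)
  push Not at hδ2
  -- As 784 = 28², this gives 28/√m ≤ δ; rounding up costs at most 1 ≤ 4/δ² because δ < 2.
  set m : ℕ := ⌈784 / δ ^ 2⌉₊ with hm
  have hm0 : 0 < m := Nat.ceil_pos.2 (by positivity)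
  have hm1 : 784 / δ ^ 2 ≤ m := Nat.le_ceil _
  have hm2 : (m : ℝ) ≤ 788 / δ ^ 2 := by
    have h1 := (Nat.ceil_lt_add_one (by positivity : 0 ≤ 784 / δ ^ 2)).le
    refine h1.trans ?_
    rw [div_add_one (by positivity), div_le_div_iff_of_pos_right (by positivity)]
    nlinarith
  have hQ : 112 * ((m : ℝ) ^ 12) ^ 9 ≤ 112 * 788 ^ 108 * δ ^ (-(216 : ℝ)) := by
    have e : δ ^ (-(216 : ℝ)) = (δ ^ 216)⁻¹ := by
      rw [Real.rpow_neg hδ.le]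
      congr 1
      exact_mod_cast Real.rpow_natCast δ 216
    rw [e, ← pow_mul, mul_assoc]
    refine mul_le_mul_of_nonneg_left ?_ (by norm_num)
    calc (m : ℝ) ^ (12 * 9) ≤ (788 / δ ^ 2) ^ (12 * 9) := by gcongr
      _ = 788 ^ 108 * (δ ^ 216)⁻¹ := by rw [div_pow, ← pow_mul, div_eq_mul_inv]
  by_cases hnr : Heis.NonRat a.x a.z N (112 * ((m : ℝ) ^ 12) ^ 9)
  · left
    refine Heis.isEquidistributed_of_normalized fun F hB hF =>
      (Heis.norm_avg_sub_integral_le hN hm0 hnr hB hF).trans ?_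
    have h1 : 28 / δ ≤ √m := by
      refine Real.le_sqrt_of_sq_le ?_
      rw [div_pow]; norm_num; exact hm1
    have h2 : 0 < √(m : ℝ) := Real.sqrt_pos.2 (by exact_mod_cast hm0)
    rw [div_le_iff₀ hδ] at h1
    rw [div_le_iff₀ h2]; linarith
  · right
    -- The failed inequality is exactly a relation (k, l) ≠ 0 with the required size and error, read
    -- as the frequency (k, l, 0).
    unfold Heis.NonRat at hnr
    push Not at hnr
    obtain ⟨k, l, hkl, hk, hl, hs⟩ := hnr
    refine ⟨Heis.horizontalCharacter k l, ?_, ?_, ?_⟩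
    · rw [Heis.modulus_horizontalCharacter, norm_pos_iff]
      intro h
      have h1 := congrFun h 0
      have h2 := congrFun h 1
      simp at h1 h2
      tauto
    · rw [Heis.modulus_horizontalCharacter]
      refine le_trans ?_ hQ
      rw [pi_norm_le_iff_of_nonneg (by positivity)]
      intro i
      fin_cases i
      · simpa [Int.norm_eq_abs] using hk
      · simpa [Int.norm_eq_abs] using hl
      · simp
    · exact hs.trans (div_le_div_of_nonneg_right hQ (Nat.cast_nonneg N))
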